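/- **Setting.** Let $\mathcal M^2$ be the set of probability distributions on $\mathbb R$ with finite second moment; identify a distribution with its distribution function $G$, and let $G^{-1}(p)=\inf\{x: G(x)\ge p\}$, $p\in(0,1)$, be its left quantile function. Let $d_W(F,G)=\big(\int_0^1|F^{-1}(t)-G^{-1}(t)|^2dt\big)^{1/2}$. Let $\mathcal H$ be the set of functions $g:[0,1]\to\mathbb R$ of bounded variation with $g(0)=g(0+)=0$ and $g(1)=g(1-)$. For $g\in\mathcal H$ put $\hat g(x)=\max\{g(x-),g(x),g(x+)\}$ for $x\in(0,1)$, $\hat g(x)=g(x)$ for $x\in\{0,1\}$, and $$\rho_g(G)=\int_0^\infty g(1-G(x))\,dx+\int_{-\infty}^0\big(g(1-G(x))-g(1)\big)\,dx,\qquad G\in\mathcal M^2,$$ with values in $[-\infty,\infty]$ (each integral being that of the positive part minus that of the negative part). Let $g^*$ be the concave envelope of $g$, that is, the pointwise infimum of all $h\in\mathcal H$ that are concave on $[0,1]$ and satisfy $h\ge g$; for a concave function, a prime denotes the right derivative on $(0,1)$. Let $F\in\mathcal M^2$ have mean $\mu_F$ and standard deviation $\sigma_F>0$, let $\mu\in\mathbb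 R$, $\sigma>0$, $\epsilon>0$, and let $\mathcal M_\epsilon(\mu,\sigma)$ be the set of all $G\in\mathcal M^2$ with mean $\mu$, second moment $\mu^2+\sigma^2$ and $d_W(G,F)\le\sqrt\epsilon$. Let $V$ be uniform on $(0,1)$, and let $c_0=\mathrm{Corr}(F^{-1}(V),(g^*)'(1-V))$, with $c_0=0$ if $(g^*)'$ is constant. For $\lambda\ge0$ put $g_\lambda(t)=g(t)+\lambda\int_{1-t}^1F^{-1}(s)\,ds$, $t\in[0,1]$, and, whenever $(g_\lambda^*)'$ is not constant, $$h_\lambda(t)=\mu+\sigma\,\frac{(g_\lambda^*)'(1-t)-a_\lambda}{b_\lambda},\quad t\in(0,1),\qquad a_\lambda=\mathbb E\big[(g_\lambda^*)'(V)\big],\quad b_\lambda=\sqrt{\mathrm{Var}\big((g_\lambda^*)'(V)\big)},$$ and let $H_\lambda$ be the distribution of $h_\lambda(V)$; its quantile function on $(0,1)$ is $h_\lambda$. **Theorem.** Let $g\in\mathcal H$ with $g=\hat g$. Assume that $\int_0^1((g^*)'(t))^2dt<\infty$ and that for every $\lambda>0$ the function $(g_\lambda^*)'$ is not constant. (i)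 Suppose $(\mu_F-\mu)^2+(\sigma_F-\sigma)^2<\epsilon<(\mu_F-\mu)^2+(\sigma_F-\sigma)^2+2\sigma_F\sigma(1-c_0)$, and suppose that $(g^*)'$ is not constant or that $g(t)<g^*(t)$ for all $t\in(0,1)$. Then there is $\lambda_\epsilon>0$ with $d_W(F,H_{\lambda_\epsilon})=\sqrt\epsilon$, and for every such $\lambda_\epsilon$ the distribution $H_{\lambda_\epsilon}$ lies in $\mathcal M_\epsilon(\mu,\sigma)$, the value $\rho_g(H_{\lambda_\epsilon})$ is finite, $$\sup_{G\in\mathcal M_\epsilon(\mu,\sigma)}\rho_g(G)=\rho_g(H_{\lambda_\epsilon}),$$ and $H_{\lambda_\epsilon}$ is the only element of $\mathcal M_\epsilon(\mu,\sigma)$ that attains the supremum. (ii) Suppose $\epsilon\ge(\mu_F-\mu)^2+(\sigma_F-\sigma)^2+2\sigma_F\sigma(1-c_0)$. If $(g^*)'$ is not constant, then $H_0\in\mathcal M_\epsilon(\mu,\sigma)$, the value $\rho_g(H_0)$ is finite, $\sup_{G\in\mathcal M_\epsilon(\mu,\sigma)}\rho_g(G)=\rho_g(H_0)$, and $H_0$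 is the only maximizer. If $(g^*)'$ is constant, then $\sup_{G\in\mathcal M_\epsilon(\mu,\sigma)}\rho_g(G)=g(1)\mu$. -/

import Mathlib

open Set Filter Topology MeasureTheory ProbabilityTheory

noncomputable section

namespace Distortion

/-- The class of distortion functions: `g : [0,1] → ℝ` of bounded variation with
`g 0 = g (0+) = 0` and `g 1 = g (1-)`. Only the values on `[0,1]` matter. -/
structure IsDistortion (g : ℝ → ℝ) : Prop where
  boundedVariation : BoundedVariationOn g (Icc 0 1)
  map_zero : g 0 = 0
  tendsto_zero : Tendsto g (𝓝[>] 0) (𝓝 0)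
  tendsto_one : Tendsto g (𝓝[<] 1) (𝓝 (g 1))

/-- The upper semicontinuous version `ĝ` of `g`. -/
def uscVersion (g : ℝ → ℝ) (x : ℝ) : ℝ :=
  open Classical in
  if x ∈ Ioo (0 : ℝ) 1 then
    max (max (Function.leftLim g x) (g x)) (Function.rightLim g x)
  else g x

/-- The concave envelope `g*` of `g` on `[0,1]`: the pointwise infimum of all concave
distortion functions that dominate `g`. -/
def concaveEnv (g : ℝ → ℝ) (t : ℝ) : ℝ :=
  sInf {y | ∃ h : ℝ → ℝ, IsDistortion h ∧ ConcaveOn ℝ (Icc 0 1) h ∧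
    (∀ s ∈ Icc (0 : ℝ) 1, g s ≤ h s) ∧ y = h t}

/-- The right derivative. -/
def rightDeriv (f : ℝ → ℝ) (t : ℝ) : ℝ :=
  derivWithin f (Ioi t) t

/-- `f` is constant on `(0,1)`. -/
def IsConstant (f : ℝ → ℝ) : Prop :=
  ∃ c : ℝ, ∀ t ∈ Ioo (0 : ℝ) 1, f t = c

/-- The left quantile function `G⁻¹(p) = inf {x | G(x) ≥ p}`, used for `p ∈ (0,1)`. -/
def quantile (G : Measure ℝ) (p : ℝ) : ℝ :=
  sInf {x : ℝ | p ≤ cdf G x}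

/-- The distribution of a random variable that is uniform on `(0,1)`. -/
def unif : Measure ℝ :=
  volume.restrict (Ioo (0 : ℝ) 1)

/-- Probability distributions on `ℝ` with finite second moment. -/
def IsM2 (G : Measure ℝ) : Prop :=
  IsProbabilityMeasure G ∧ MemLp (fun x : ℝ => x) 2 G

/-- The mean of a distribution. -/
def mean (G : Measure ℝ) : ℝ :=
  ∫ x, x ∂G

/-- The standard deviation of a distribution. -/
def stdDev (G : Measure ℝ) : ℝ :=
  Real.sqrt (variance (fun x : ℝ => x) G)

/-- The `2`-Wasserstein distance of distributions in dimension one. -/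
def dW (F G : Measure ℝ) : ℝ :=
  Real.sqrt (∫ t in Ioo (0 : ℝ) 1, |quantile F t - quantile G t| ^ 2)

/-- The integral of `f` over `s` with values in `[-∞, ∞]`: the integral of the positive part
minus the integral of the negative part. -/
def extIntegral (s : Set ℝ) (f : ℝ → ℝ) : EReal :=
  ((∫⁻ x in s, ENNReal.ofReal (f x) : ENNReal) : EReal) -
    ((∫⁻ x in s, ENNReal.ofReal (-f x) : ENNReal) : EReal)

/-- The distortion risk metric
`ρ_g(G) = ∫_0^∞ g(1 - G(x)) dx + ∫_{-∞}^0 (g(1 - G(x)) - g(1)) dx`.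
It is extended-real valued, because for a distribution with heavy tails the negative parts of
the integrands need not be integrable. -/
def rho (g : ℝ → ℝ) (G : Measure ℝ) : EReal :=
  extIntegral (Ioi 0) (fun x => g (1 - cdf G x)) +
    extIntegral (Iio 0) (fun x => g (1 - cdf G x) - g 1)

/-- The uncertainty set: distributions with mean `μ`, second moment `μ² + σ²` and Wasserstein
distance at most `√ε` from `F`. -/
def uncertaintySet (F : Measure ℝ) (μ σ ε : ℝ) : Set (Measure ℝ) :=
  {G | IsM2 G ∧ ∫ x, x ∂G = μ ∧ ∫ x, x ^ 2 ∂G = μ ^ 2 + σ ^ 2 ∧ dW G F ≤ Real.sqrt ε}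

/-- The function `g_lam(t) = g(t) + lam * ∫_{1-t}^1 F⁻¹(s) ds`. -/
def tilt (g : ℝ → ℝ) (F : Measure ℝ) (lam : ℝ) (t : ℝ) : ℝ :=
  g t + lam * ∫ s in (1 - t)..1, quantile F s

/-- The right derivative `(g_lam*)'` of the concave envelope of `g_lam`. -/
def envDeriv (g : ℝ → ℝ) (F : Measure ℝ) (lam : ℝ) : ℝ → ℝ :=
  rightDeriv (concaveEnv (tilt g F lam))

/-- The function
`h_lam(t) = μ + σ * ((g_lam*)'(1 - t) - a_lam) / b_lam`, where `a_lam` and `b_lam` are the mean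
and the standard deviation of `(g_lam*)'(V)` for `V` uniform on `(0,1)`. -/
def worstQuantile (g : ℝ → ℝ) (F : Measure ℝ) (μ σ lam : ℝ) (t : ℝ) : ℝ :=
  μ + σ * ((envDeriv g F lam (1 - t) - ∫ v, envDeriv g F lam v ∂unif) /
    Real.sqrt (variance (envDeriv g F lam) unif))

/-- The distribution `H_lam`, i.e. the law of `h_lam(V)` for `V` uniform on `(0,1)`. -/
def worstDist (g : ℝ → ℝ) (F : Measure ℝ) (μ σ lam : ℝ) : Measure ℝ :=
  unif.map (worstQuantile g F μ σ lam)

/-- Pearson's correlation coefficient; it is `0` if one of the variables is constant. -/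
def corr (X Y : ℝ → ℝ) (P : Measure ℝ) : ℝ :=
  covariance X Y P / (Real.sqrt (variance X P) * Real.sqrt (variance Y P))

/-- The number `c₀ = Corr(F⁻¹(V), (g*)'(1 - V))`, which is `0` if `(g*)'` is constant. -/
def c0 (g : ℝ → ℝ) (F : Measure ℝ) : ℝ :=
  corr (quantile F) (fun v => rightDeriv (concaveEnv g) (1 - v)) unif

/-- `H` is the unique maximizer of `ρ_g` over `S`, and the maximum is finite. -/
def IsUniqueWorstCase (g : ℝ → ℝ) (S : Set (Measure ℝ)) (H : Measure ℝ) : Prop :=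
  H ∈ S ∧ (∃ r : ℝ, rho g H = (r : EReal)) ∧ (⨆ G ∈ S, rho g G) = rho g H ∧
    ∀ G ∈ S, rho g G = rho g H → G = H

end Distortion

end

namespace Distortion

/-! If a distortion function `v` has a density `w`, Fubini gives `ρ_v(G) = ∫ q(t) w(1-t) dt`, where
`q` is the quantile function of `G` (`rho_eq_integral`). Let `f` be the quantile function of `F` and
`P_λ(t) = (g_λ*)'(1-t)`. Since `g_λ ≤ g_λ*`, subtracting the tilt again yields, for every `λ ≥ 0`,
the bound `ρ_g(G) ≤ ⟨q, P_λ - λ f⟩` in `L²(0,1)` (`rho_le_integral`). This is weak duality with `λ`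
the multiplier of the Wasserstein constraint: once the first two moments are fixed, that constraint
is a lower bound on `⟨f, q⟩`. Among the `q` with the prescribed moments, `⟨q, P_λ⟩` is largest at
the standardization `h_λ` of `P_λ` and falls short elsewhere by a multiple of `‖q - h_λ‖²`, which
gives optimality and uniqueness at once (`isUniqueWorstCase_worstDist`). The law `H_λ` attains the
bound: where `g_λ < g_λ*` the envelope is affine, so `h_λ` is flat and `1 - H_λ(x)` skips these
points (`env_eq_of_quantile`).

It remains to find `λ`. Expanding the square shows that `d_W(F, H_λ)` depends on `λ` only through
`Corr(f, P_λ)`, so every correlation in `(c₀, 1)` has to be reached. Testing the bound at level `λ`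
with the law of `P_λ'` gives `⟨P_λ', P_λ' - λ' f⟩ ≤ ⟨P_λ', P_λ - λ f⟩` (`envDeriv_variational`).
Hence `λ ↦ P_λ` is Lipschitz; testing with bounded laws as well gives `P_λ / λ → f`. So the
correlation is continuous where the variance of `P_λ` is positive, and it tends to `1`. If `(g*)'`
is not constant, continuity at `λ = 0` supplies correlations near `c₀`. If it is constant, the
variance vanishes at `0`; then `g < g*` leaves room for a small multiple of an approximation to the
centred `f`, and this forces small correlations (`exists_envCorr_lt_of_linear`).

For a large radius and constant `(g*)'`, the correlations are nonnegative, so every `H_λ` with `λ >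
0` is feasible, and the values approach `g(1) μ` as `λ → 0`. -/

/-! ### The uniform law and quantile functions -/

instance : IsProbabilityMeasure unif :=
  ⟨by simp [unif]⟩

lemma ae_unif_mem : ∀ᵐ t ∂unif, t ∈ Ioo (0 : ℝ) 1 :=
  ae_restrict_mem measurableSet_Ioo

lemma measurePreserving_one_sub : MeasurePreserving (fun t : ℝ => 1 - t) unif unif := by
  have h := (Measure.measurePreserving_sub_left (volume : Measure ℝ) (1 : ℝ)).restrict_preimage
    (s := Ioo (0 : ℝ) 1) measurableSet_Ioo
  have h2 : (fun t : ℝ => 1 - t) ⁻¹' Ioo (0 : ℝ) 1 = Ioo 0 1 := by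
    ext t; simp only [mem_preimage, mem_Ioo]; constructor <;> intro ⟨_, _⟩ <;> constructor <;> linarith
  rw [h2] at h
  exact h

lemma integral_comp_one_sub (f : ℝ → ℝ) : ∫ t, f (1 - t) ∂unif = ∫ t, f t ∂unif :=
  measurePreserving_one_sub.integral_comp (Homeomorph.subLeft (1 : ℝ)).measurableEmbedding f

lemma integrable_comp_one_sub {f : ℝ → ℝ} (hf : Integrable f unif) :
    Integrable (fun t => f (1 - t)) unif :=
  measurePreserving_one_sub.integrable_comp_of_integrable hf

lemma memLp_comp_one_sub {f : ℝ → ℝ} (hf : MemLp f 2 unif) :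
    MemLp (fun t => f (1 - t)) 2 unif :=
  hf.comp_measurePreserving measurePreserving_one_sub

/-- `q` is a version on `(0,1)` of the left quantile function of `G`, expressed by the Galois
connection with the distribution function. -/
def IsQuantileOf (q : ℝ → ℝ) (G : Measure ℝ) : Prop :=
  ∀ p ∈ Ioo (0 : ℝ) 1, ∀ x, q p ≤ x ↔ p ≤ cdf G x

/-- Right continuity of the distribution function makes the infimum a minimum, which is the
nontrivial direction of the Galois connection. -/
lemma isQuantileOf_quantile (G : Measure ℝ) [IsProbabilityMeasure G] :
    IsQuantileOf (quantile G) G := by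
  intro p hp x
  have hbdd : BddBelow {x : ℝ | p ≤ cdf G x} := by
    obtain ⟨y, hy⟩ := ((tendsto_cdf_atBot G).eventually (gt_mem_nhds hp.1)).exists
    refine ⟨y, fun z hz => ?_⟩
    by_contra! h
    exact absurd (hz.trans (monotone_cdf G h.le)) (not_le.2 hy)
  have hne : {x : ℝ | p ≤ cdf G x}.Nonempty := by
    obtain ⟨y, hy⟩ := ((tendsto_cdf_atTop G).eventually (lt_mem_nhds hp.2)).exists
    exact ⟨y, hy.le⟩
  refine ⟨fun h => ?_, fun h => csInf_le hbdd h⟩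
  have hright : Tendsto (cdf G) (𝓝[>] x) (𝓝 (cdf G x)) :=
    ((cdf G).right_continuous x).mono_left (nhdsWithin_mono _ Ioi_subset_Ici_self)
  refine ge_of_tendsto hright ?_
  filter_upwards [self_mem_nhdsWithin] with y hy
  obtain ⟨z, hz, hzy⟩ := exists_lt_of_csInf_lt hne (lt_of_le_of_lt h hy)
  exact le_trans hz (monotone_cdf G hzy.le)

namespace IsQuantileOf

variable {q : ℝ → ℝ} {G : Measure ℝ}

lemma quantile_eq (h : IsQuantileOf q G) {p : ℝ} (hp : p ∈ Ioo (0 : ℝ) 1) :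
    quantile G p = q p := by
  have : {x : ℝ | p ≤ cdf G x} = Ici (q p) := by
    ext x; exact (h p hp x).symm
  rw [quantile, this, csInf_Ici]

lemma lt_iff (h : IsQuantileOf q G) {p : ℝ} (hp : p ∈ Ioo (0 : ℝ) 1) (x : ℝ) :
    x < q p ↔ cdf G x < p := by
  simpa only [not_le] using not_congr (h p hp x)

lemma monotoneOn (h : IsQuantileOf q G) : MonotoneOn q (Ioo 0 1) := fun p hp p' hp' hpp =>
  (h p hp _).2 (hpp.trans ((h p' hp' _).1 le_rfl))

lemma aemeasurable (h : IsQuantileOf q G) : AEMeasurable q unif :=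
  aemeasurable_restrict_of_monotoneOn measurableSet_Ioo h.monotoneOn

lemma map_eq [IsProbabilityMeasure G] (h : IsQuantileOf q G) : unif.map q = G := by
  have : IsProbabilityMeasure (unif.map q) := Measure.isProbabilityMeasure_map h.aemeasurable
  refine Measure.ext_of_Iic _ _ fun x => ?_
  rw [Measure.map_apply_of_aemeasurable h.aemeasurable measurableSet_Iic, ← ofReal_cdf G x, unif,
    Measure.restrict_apply' measurableSet_Ioo]
  have h0 := cdf_nonneg G x
  have h1 := cdf_le_one G x
  have : volume (q ⁻¹' Iic x ∩ Ioo 0 1) = volume (Ioc 0 (cdf G x)) := by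
    refine measure_congr ?_
    -- The point `1` has to be discarded: it lies in `Ioc 0 (cdf G x)` when `cdf G x = 1`, but not
    -- in `Ioo 0 1`.
    have h1' : ∀ᵐ t : ℝ, t ≠ 1 := Measure.ae_ne volume 1
    filter_upwards [h1'] with t ht
    refine propext ⟨fun ⟨ha, hb⟩ => ⟨hb.1, (h t hb x).1 ha⟩, fun ⟨ha, hb⟩ => ?_⟩
    have : t ∈ Ioo (0 : ℝ) 1 := ⟨ha, lt_of_le_of_ne (hb.trans h1) ht⟩
    exact ⟨(h t this x).2 hb, this⟩
  rw [this, Real.volume_Ioc, sub_zero]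

lemma integral_comp [IsProbabilityMeasure G] (h : IsQuantileOf q G) {φ : ℝ → ℝ}
    (hφ : Continuous φ) : ∫ x, φ x ∂G = ∫ t, φ (q t) ∂unif := by
  conv_lhs => rw [← h.map_eq]
  exact integral_map h.aemeasurable hφ.aestronglyMeasurable

lemma memLp_iff [IsProbabilityMeasure G] (h : IsQuantileOf q G) :
    MemLp (fun x : ℝ => x) 2 G ↔ MemLp q 2 unif := by
  conv_lhs => rw [← h.map_eq]
  exact memLp_map_measure_iff continuous_id.aestronglyMeasurable h.aemeasurable

end IsQuantileOf

/-- Monotonicity bounds the distribution function from below. The converse needs left continuity,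
because the mass of a sublevel set controls `q` only strictly to the left of `p`. -/
lemma isQuantileOf_map {q : ℝ → ℝ} (hq : MonotoneOn q (Ioo 0 1))
    (hc : ∀ p ∈ Ioo (0 : ℝ) 1, Tendsto q (𝓝[<] p) (𝓝 (q p))) :
    IsQuantileOf q (unif.map q) := by
  have hqm : AEMeasurable q unif := aemeasurable_restrict_of_monotoneOn measurableSet_Ioo hq
  have : IsProbabilityMeasure (unif.map q) := Measure.isProbabilityMeasure_map hqm
  intro p hp x
  have key : ENNReal.ofReal (cdf (unif.map q) x) = volume (q ⁻¹' Iic x ∩ Ioo 0 1) := by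
    rw [ofReal_cdf, Measure.map_apply_of_aemeasurable hqm measurableSet_Iic, unif,
      Measure.restrict_apply' measurableSet_Ioo]
  constructor
  · intro h
    have : Ioc 0 p ⊆ q ⁻¹' Iic x ∩ Ioo 0 1 := fun t ht =>
      ⟨(hq ⟨ht.1, ht.2.trans_lt hp.2⟩ hp ht.2).trans h, ht.1, ht.2.trans_lt hp.2⟩
    have := measure_mono (μ := volume) this
    rw [← key, Real.volume_Ioc, sub_zero, ENNReal.ofReal_le_ofReal_iff (cdf_nonneg _ _)] at this
    exact this
  · intro h
    refine le_of_tendsto (hc p hp) ?_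
    filter_upwards [Ioo_mem_nhdsLT hp.1] with t ht
    by_contra! hlt
    have hsub : q ⁻¹' Iic x ∩ Ioo 0 1 ⊆ Ioo 0 t := by
      rintro s ⟨hs, hs0, hs1⟩
      refine ⟨hs0, ?_⟩
      by_contra! hts
      exact absurd (hs : q s ≤ x)
        (not_le.2 (hlt.trans_le (hq ⟨ht.1, ht.2.trans hp.2⟩ ⟨hs0, hs1⟩ hts)))
    have := measure_mono (μ := volume) hsub
    rw [← key, Real.volume_Ioo, sub_zero, ENNReal.ofReal_le_ofReal_iff ht.1.le] at this
    linarith [ht.2]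

/-! ### The distortion metric as an integral of the quantile function -/

lemma extIntegral_of_integrableOn {s : Set ℝ} {f : ℝ → ℝ} (h : IntegrableOn f s) :
    extIntegral s f = ((∫ x in s, f x : ℝ) : EReal) := by
  have h1 : (∫⁻ x in s, ENNReal.ofReal (f x)) ≠ ⊤ := h.lintegral_lt_top.ne
  have h2 : (∫⁻ x in s, ENNReal.ofReal (-f x)) ≠ ⊤ := h.neg.lintegral_lt_top.ne
  rw [integral_eq_lintegral_pos_part_sub_lintegral_neg_part h, extIntegral, EReal.coe_sub,
    EReal.coe_ennreal_toReal h1, EReal.coe_ennreal_toReal h2]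

lemma extIntegral_mono {s : Set ℝ} (hs : MeasurableSet s) {f w : ℝ → ℝ}
    (h : ∀ x ∈ s, f x ≤ w x) : extIntegral s f ≤ extIntegral s w := by
  refine EReal.sub_le_sub ?_ ?_
  · exact EReal.coe_ennreal_le_coe_ennreal_iff.2
      (setLIntegral_mono' hs fun x hx => ENNReal.ofReal_le_ofReal (h x hx))
  · exact EReal.coe_ennreal_le_coe_ennreal_iff.2
      (setLIntegral_mono' hs fun x hx => ENNReal.ofReal_le_ofReal (neg_le_neg (h x hx)))

lemma one_sub_cdf_mem (G : Measure ℝ) (x : ℝ) : 1 - cdf G x ∈ Icc (0 : ℝ) 1 :=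
  ⟨by linarith [cdf_le_one G x], by linarith [cdf_nonneg G x]⟩

/-- The values at `1` have to agree because they are subtracted on the negative half line. -/
lemma rho_mono {g v : ℝ → ℝ} (h : ∀ t ∈ Icc (0 : ℝ) 1, g t ≤ v t) (h1 : g 1 = v 1)
    (G : Measure ℝ) : rho g G ≤ rho v G := by
  refine add_le_add (extIntegral_mono measurableSet_Ioi fun x _ => h _ (one_sub_cdf_mem G x))
    (extIntegral_mono measurableSet_Iio fun x _ => ?_)
  rw [h1]
  exact sub_le_sub_right (h _ (one_sub_cdf_mem G x)) _

lemma rho_congr {g v : ℝ → ℝ} {G : Measure ℝ} (h : ∀ x, g (1 - cdf G x) = v (1 - cdf G x))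
    (h1 : g 1 = v 1) : rho g G = rho v G := by
  simp only [rho, h, h1]

/-- Fubini for a region in the plane with `m t` the length of its section at height `t`.
Integrability of `m * w` is what Tonelli asks for, so integrability in `x` is a conclusion and need
not be checked. -/
lemma integral_indicator_swap {μ ν : Measure ℝ} [SFinite μ] [SFinite ν] {A : Set (ℝ × ℝ)}
    (hA : MeasurableSet A) {m w : ℝ → ℝ} (hm0 : ∀ t, 0 ≤ m t) (hw : AEStronglyMeasurable w ν)
    (hm : ∀ᵐ t ∂ν, μ {x | (x, t) ∈ A} = ENNReal.ofReal (m t))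
    (hint : Integrable (fun t => m t * w t) ν) :
    Integrable (fun x => ∫ t, A.indicator (fun z => w z.2) (x, t) ∂ν) μ ∧
      ∫ x, (∫ t, A.indicator (fun z => w z.2) (x, t) ∂ν) ∂μ = ∫ t, m t * w t ∂ν := by
  have hsec : ∀ t, MeasurableSet {x | (x, t) ∈ A} := fun t => measurable_prodMk_right hA
  have hrw : ∀ t (f : ℝ → ℝ), (fun x => A.indicator (fun z => f z.2) (x, t)) =
      {x | (x, t) ∈ A}.indicator (fun _ => f t) := by
    intro t f; ext x; by_cases h : (x, t) ∈ A <;> simp [indicator, h]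
  have hval : ∀ f : ℝ → ℝ, ∀ᵐ t ∂ν,
      ∫ x, A.indicator (fun z => f z.2) (x, t) ∂μ = m t * f t := by
    intro f
    filter_upwards [hm] with t ht
    rw [hrw, integral_indicator_const _ (hsec t), Measure.real, ht, ENNReal.toReal_ofReal (hm0 t),
      smul_eq_mul]
  have hI : Integrable (Function.uncurry fun x t => A.indicator (fun z => w z.2) (x, t))
      (μ.prod ν) := by
    have : (Function.uncurry fun x t => A.indicator (fun z : ℝ × ℝ => w z.2) (x, t)) =
      A.indicator (fun z : ℝ × ℝ => w z.2) := rfl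
    rw [this, integrable_prod_iff' (hw.comp_snd.indicator hA)]
    constructor
    · filter_upwards [hm] with t ht
      rw [hrw]
      refine (integrable_indicator_iff (hsec t)).2 (integrableOn_const ?_)
      rw [ht]; exact ENNReal.ofReal_ne_top
    · refine (hint.norm).congr ?_
      filter_upwards [hval fun t => ‖w t‖] with t ht
      rw [norm_mul, Real.norm_of_nonneg (hm0 t), ← ht]
      refine integral_congr_ae (Eventually.of_forall fun x => ?_)
      exact (norm_indicator_eq_indicator_norm (fun z : ℝ × ℝ => w z.2) (x, t)).symm
  exact ⟨hI.integral_prod_left, (integral_integral_swap hI).trans (integral_congr_ae (hval w))⟩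

lemma setIntegral_unif_Ioi {w : ℝ → ℝ} {c : ℝ} (hc : c ∈ Icc (0 : ℝ) 1) :
    ∫ t in Ioi c, w (1 - t) ∂unif = ∫ s in (0 : ℝ)..(1 - c), w s := by
  have h : ∫ s in (0 : ℝ)..(1 - c), w s = ∫ t in c..1, w (1 - t) := by
    rw [intervalIntegral.integral_comp_sub_left w 1, sub_self]
  rw [h, intervalIntegral.integral_of_le hc.2, integral_Ioc_eq_integral_Ioo, unif,
    Measure.restrict_restrict measurableSet_Ioi]
  congr 2
  ext t
  simp only [mem_inter_iff, mem_Ioi, mem_Ioo]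
  exact ⟨fun ⟨a, _, b⟩ => ⟨a, b⟩, fun ⟨a, b⟩ => ⟨a, hc.1.trans_lt a, b⟩⟩

/-- The distortion risk metric of an absolutely continuous distortion function as an integral of
the quantile function against the density. -/
lemma rho_eq_integral {v w q : ℝ → ℝ} {G : Measure ℝ} (hq : IsQuantileOf q G)
    (hw : Integrable w unif) (hqw : Integrable (fun t => q t * w (1 - t)) unif)
    (hv : ∀ t ∈ Icc (0 : ℝ) 1, v t = ∫ s in (0 : ℝ)..t, w s) :
    rho v G = ((∫ t, q t * w (1 - t) ∂unif : ℝ) : EReal) := by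
  have hw' := integrable_comp_one_sub hw
  have hcdf : Measurable fun z : ℝ × ℝ => cdf G z.1 :=
    (monotone_cdf G).measurable.comp measurable_fst
  have hpos : Integrable (fun t => max (q t) 0 * w (1 - t)) unif := by
    refine hqw.mono ((hq.aemeasurable.max aemeasurable_const).aestronglyMeasurable.mul
      hw'.aestronglyMeasurable) (Eventually.of_forall fun t => ?_)
    rw [norm_mul, norm_mul]
    refine mul_le_mul_of_nonneg_right ?_ (norm_nonneg _)
    simp only [Real.norm_eq_abs]
    rw [abs_of_nonneg (le_max_right _ _)]
    exact max_le (le_abs_self _) (abs_nonneg _)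
  have hneg : Integrable (fun t => max (-q t) 0 * w (1 - t)) unif := by
    refine hqw.mono ((hq.aemeasurable.neg.max aemeasurable_const).aestronglyMeasurable.mul
      hw'.aestronglyMeasurable) (Eventually.of_forall fun t => ?_)
    rw [norm_mul, norm_mul]
    refine mul_le_mul_of_nonneg_right ?_ (norm_nonneg _)
    simp only [Real.norm_eq_abs]
    rw [abs_of_nonneg (le_max_right _ _)]
    exact max_le (neg_le_abs _) (abs_nonneg _)
  have hA : MeasurableSet {z : ℝ × ℝ | cdf G z.1 < z.2} := measurableSet_lt hcdf measurable_snd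
  have hB : MeasurableSet {z : ℝ × ℝ | z.2 ≤ cdf G z.1} := measurableSet_le measurable_snd hcdf
  -- Layer cake on the positive half line: `cdf G x < t` means `x < q t`, so the section at height
  -- `t` has length the positive part of `q t`.
  obtain ⟨hA1, hA2⟩ := integral_indicator_swap (μ := volume.restrict (Ioi 0)) (ν := unif) hA
    (m := fun t => max (q t) 0) (w := fun t => w (1 - t)) (fun t => le_max_right _ _)
    hw'.aestronglyMeasurable (by
      filter_upwards [ae_unif_mem] with t ht
      rw [Measure.restrict_apply' measurableSet_Ioi]
      have : {x | cdf G x < t} ∩ Ioi 0 = Ioo 0 (q t) := by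
        ext x
        simp only [mem_inter_iff, mem_ofPred_eq, mem_Ioi, mem_Ioo, ← hq.lt_iff ht]
        exact and_comm
      rw [this, Real.volume_Ioo, sub_zero, ENNReal.ofReal_max, ENNReal.ofReal_zero]
      simp) hpos
  -- On the negative half line the complementary region is used; its sections have length the
  -- negative part of `q t`.
  obtain ⟨hB1, hB2⟩ := integral_indicator_swap (μ := volume.restrict (Iio 0)) (ν := unif) hB
    (m := fun t => max (-q t) 0) (w := fun t => w (1 - t)) (fun t => le_max_right _ _)
    hw'.aestronglyMeasurable (by
      filter_upwards [ae_unif_mem] with t ht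
      rw [Measure.restrict_apply' measurableSet_Iio]
      have : {x | t ≤ cdf G x} ∩ Iio 0 = Ico (q t) 0 := by
        ext x
        simp only [mem_inter_iff, mem_ofPred_eq, mem_Iio, mem_Ico, ← hq t ht]
      rw [this, Real.volume_Ico, zero_sub, ENNReal.ofReal_max, ENNReal.ofReal_zero]
      simp) hneg
  have hIoi : ∀ x, ∫ t, {z : ℝ × ℝ | cdf G z.1 < z.2}.indicator (fun z => w (1 - z.2)) (x, t) ∂unif
      = v (1 - cdf G x) := by
    intro x
    have : (fun t => {z : ℝ × ℝ | cdf G z.1 < z.2}.indicator (fun z => w (1 - z.2)) (x, t)) =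
        (Ioi (cdf G x)).indicator fun t => w (1 - t) := by
      ext t; simp [indicator]
    rw [this, integral_indicator measurableSet_Ioi,
      setIntegral_unif_Ioi ⟨cdf_nonneg G x, cdf_le_one G x⟩, hv _ (one_sub_cdf_mem G x)]
  have hv1 : v 1 = ∫ t, w (1 - t) ∂unif := by
    rw [hv 1 (by simp), integral_comp_one_sub, intervalIntegral.integral_of_le zero_le_one,
      integral_Ioc_eq_integral_Ioo, unif]
  have hIio : ∀ x, ∫ t, {z : ℝ × ℝ | z.2 ≤ cdf G z.1}.indicator (fun z => w (1 - z.2)) (x, t) ∂unif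
      = - (v (1 - cdf G x) - v 1) := by
    intro x
    have : (fun t => {z : ℝ × ℝ | z.2 ≤ cdf G z.1}.indicator (fun z => w (1 - z.2)) (x, t)) =
        (Iic (cdf G x)).indicator fun t => w (1 - t) := by
      ext t; simp [indicator]
    rw [this, integral_indicator measurableSet_Iic, hv1, hv _ (one_sub_cdf_mem G x),
      ← setIntegral_unif_Ioi ⟨cdf_nonneg G x, cdf_le_one G x⟩, ← compl_Iic]
    linarith [integral_add_compl (μ := unif) (measurableSet_Iic (a := cdf G x)) hw']
  simp only [hIoi] at hA1 hA2
  simp only [hIio] at hB1 hB2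
  have hB1' : IntegrableOn (fun x => v (1 - cdf G x) - v 1) (Iio 0) := by
    refine hB1.neg.congr (Eventually.of_forall fun x => ?_)
    simp
  rw [integral_neg] at hB2
  rw [rho, extIntegral_of_integrableOn hA1, extIntegral_of_integrableOn hB1', ← EReal.coe_add,
    hA2, neg_eq_iff_eq_neg.1 hB2, ← sub_eq_add_neg, ← integral_sub hpos hneg]
  congr 1
  refine integral_congr_ae (Eventually.of_forall fun t => ?_)
  simp only [← sub_mul]
  congr 1
  rcases le_total (q t) 0 with h | h
  · rw [max_eq_right h, max_eq_left (by linarith)]; ring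
  · rw [max_eq_left h, max_eq_right (by linarith)]; ring

/-! ### Concave functions and their right derivatives -/

section Concave

variable {u : ℝ → ℝ}

lemma hasDerivWithinAt_rightDeriv (hu : ConcaveOn ℝ (Icc 0 1) u) {t : ℝ}
    (ht : t ∈ Ioo (0 : ℝ) 1) : HasDerivWithinAt u (rightDeriv u t) (Ioi t) t := by
  have h := (hu.neg.differentiableWithinAt_Ioi_of_mem_interior (by rwa [interior_Icc])).neg
  rw [neg_neg] at h
  exact h.hasDerivWithinAt

lemma slope_le_rightDeriv (hu : ConcaveOn ℝ (Icc 0 1) u) {t s : ℝ} (ht : t ∈ Ioo (0 : ℝ) 1)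
    (hts : t < s) (hs : s ≤ 1) : slope u t s ≤ rightDeriv u t :=
  hu.slope_le_rightDeriv ⟨ht.1.le, ht.2.le⟩ ⟨ht.1.le.trans hts.le, hs⟩ hts
    (hasDerivWithinAt_rightDeriv hu ht).differentiableWithinAt

lemma antitoneOn_rightDeriv (hu : ConcaveOn ℝ (Icc 0 1) u) :
    AntitoneOn (rightDeriv u) (Ioo 0 1) := by
  have h := hu.neg.monotoneOn_rightDeriv
  rw [interior_Icc] at h
  intro x hx y hy hxy
  have := h hx hy hxy
  simp only [derivWithin.neg, neg_le_neg_iff] at this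
  exact this

lemma continuousAt_of_concaveOn (hu : ConcaveOn ℝ (Icc 0 1) u) {t : ℝ}
    (ht : t ∈ Ioo (0 : ℝ) 1) : ContinuousAt u t := by
  have h := hu.continuousOn_interior
  rw [interior_Icc] at h
  exact h.continuousAt (Ioo_mem_nhds ht.1 ht.2)

/-- Slopes to a fixed later point are continuous in the left end point and lie below the right
derivative, which gives the lower bound; antitonicity gives the upper one. After reflection this is
the left continuity of a quantile function. -/
lemma tendsto_rightDeriv (hu : ConcaveOn ℝ (Icc 0 1) u) {t : ℝ} (ht : t ∈ Ioo (0 : ℝ) 1) :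
    Tendsto (rightDeriv u) (𝓝[>] t) (𝓝 (rightDeriv u t)) := by
  have hmem : Ioo t 1 ∈ 𝓝[>] t := Ioo_mem_nhdsGT ht.2
  refine tendsto_order.2 ⟨fun a ha => ?_, fun a ha => ?_⟩
  · have h1 := (hasDerivWithinAt_iff_tendsto_slope' (self_notMem_Ioi)).1
      (hasDerivWithinAt_rightDeriv hu ht)
    obtain ⟨s, hs, hts, hs1⟩ := ((h1.eventually (lt_mem_nhds ha)).and hmem).exists
    have hc : Tendsto (fun r => slope u r s) (𝓝 t) (𝓝 (slope u t s)) := by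
      simp only [slope_def_field]
      exact (tendsto_const_nhds.sub (continuousAt_of_concaveOn hu ht)).div
        (tendsto_const_nhds.sub tendsto_id) (sub_ne_zero.2 hts.ne')
    have h2 : ∀ᶠ r in 𝓝[>] t, a < slope u r s :=
      (hc.mono_left nhdsWithin_le_nhds).eventually (lt_mem_nhds hs)
    filter_upwards [h2, Ioo_mem_nhdsGT hts] with r hr hrs
    exact hr.trans_le (slope_le_rightDeriv hu ⟨ht.1.trans hrs.1, hrs.2.trans hs1⟩ hrs.2 hs1.le)
  · filter_upwards [hmem] with s hs
    exact (antitoneOn_rightDeriv hu ht ⟨ht.1.trans hs.1, hs.2⟩ hs.1.le).trans_lt ha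

/-- Subtracting the value at `1/2` gives the derivative a constant sign on each half, and a
one-signed derivative of a continuous function is integrable even if it blows up at the end points.
-/
lemma integrable_rightDeriv (hu : ConcaveOn ℝ (Icc 0 1) u) (hc : ContinuousOn u (Icc 0 1)) :
    Integrable (rightDeriv u) unif := by
  set c := rightDeriv u (1 / 2) with hcdef
  have hhalf : (1 / 2 : ℝ) ∈ Ioo (0 : ℝ) 1 := by norm_num
  have h1 : IntegrableOn (fun t => rightDeriv u t - c) (Ioc 0 (1 / 2)) := by
    refine intervalIntegral.integrableOn_deriv_right_of_nonneg (g := fun t => u t - c * t)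
      ((hc.mono (Icc_subset_Icc_right hhalf.2.le)).sub (by fun_prop)) (fun x hx => ?_)
      fun x hx => ?_
    · have hx' : x ∈ Ioo (0 : ℝ) 1 := ⟨hx.1, hx.2.trans hhalf.2⟩
      have h := (hasDerivWithinAt_rightDeriv hu hx').sub
        ((hasDerivWithinAt_id x (Ioi x)).const_mul c)
      rw [mul_one] at h
      exact h
    · exact sub_nonneg.2 (antitoneOn_rightDeriv hu ⟨hx.1, hx.2.trans hhalf.2⟩ hhalf hx.2.le)
  have h2 : IntegrableOn (fun t => c - rightDeriv u t) (Ioc (1 / 2) 1) := by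
    refine intervalIntegral.integrableOn_deriv_right_of_nonneg (g := fun t => c * t - u t)
      (ContinuousOn.sub (by fun_prop) (hc.mono (Icc_subset_Icc_left hhalf.1.le)))
      (fun x hx => ?_) fun x hx => ?_
    · have hx' : x ∈ Ioo (0 : ℝ) 1 := ⟨hhalf.1.trans hx.1, hx.2⟩
      have h := ((hasDerivWithinAt_id x (Ioi x)).const_mul c).sub
        (hasDerivWithinAt_rightDeriv hu hx')
      rw [mul_one] at h
      exact h
    · exact sub_nonneg.2 (antitoneOn_rightDeriv hu hhalf ⟨hhalf.1.trans hx.1, hx.2⟩ hx.1.le)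
  have h1' : IntegrableOn (rightDeriv u) (Ioc 0 (1 / 2)) := by
    have := h1.add (integrableOn_const (C := c) (by simp))
    exact this.congr (Eventually.of_forall fun t => by simp)
  have h2' : IntegrableOn (rightDeriv u) (Ioc (1 / 2) 1) := by
    have := (integrableOn_const (C := c) (μ := volume) (s := Ioc (1 / 2 : ℝ) 1) (by simp)).sub h2
    exact this.congr (Eventually.of_forall fun t => by simp)
  have h3 := h1'.union h2'
  rw [Ioc_union_Ioc_eq_Ioc hhalf.1.le hhalf.2.le] at h3
  exact h3.mono_set Ioo_subset_Ioc_self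

lemma intervalIntegrable_of_unif {w : ℝ → ℝ} (hw : Integrable w unif) {a b : ℝ}
    (ha : a ∈ Icc (0 : ℝ) 1) (hb : b ∈ Icc (0 : ℝ) 1) : IntervalIntegrable w volume a b := by
  have h : IntegrableOn w (Ioc 0 1) := by
    rw [integrableOn_Ioc_iff_integrableOn_Ioo]; exact hw
  exact ⟨h.mono_set (Ioc_subset_Ioc ha.1 hb.2), h.mono_set (Ioc_subset_Ioc hb.1 ha.2)⟩

lemma eq_integral_rightDeriv (hu : ConcaveOn ℝ (Icc 0 1) u) (hc : ContinuousOn u (Icc 0 1))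
    (h0 : u 0 = 0) {t : ℝ} (ht : t ∈ Icc (0 : ℝ) 1) :
    u t = ∫ s in (0 : ℝ)..t, rightDeriv u s := by
  rw [intervalIntegral.integral_eq_sub_of_hasDeriv_right (f := u), h0, sub_zero]
  · rw [uIcc_of_le ht.1]; exact hc.mono (Icc_subset_Icc_right ht.2)
  · rw [min_eq_left ht.1, max_eq_right ht.1]
    exact fun x hx => hasDerivWithinAt_rightDeriv hu ⟨hx.1, hx.2.trans_le ht.2⟩
  · exact intervalIntegrable_of_unif (integrable_rightDeriv hu hc) (by simp) ht

/-- A concave function is monotone on either side of a maximum point. -/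
lemma boundedVariationOn_of_concaveOn (hu : ConcaveOn ℝ (Icc 0 1) u)
    (hc : ContinuousOn u (Icc 0 1)) : BoundedVariationOn u (Icc 0 1) := by
  obtain ⟨m, hm, hmax⟩ := isCompact_Icc.exists_isMaxOn (nonempty_Icc.2 zero_le_one) hc
  obtain ⟨C, hC⟩ := isCompact_Icc.exists_bound_of_continuousOn hc
  have h1 : MonotoneOn u (Icc 0 m) := fun x hx y hy hxy => by
    have := hu.min_le_of_mem_Icc ⟨hx.1, hx.2.trans hm.2⟩ hm ⟨hxy, hy.2⟩
    rwa [min_eq_left (hmax ⟨hx.1, hx.2.trans hm.2⟩)] at this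
  have h2 : MonotoneOn (-u) (Icc m 1) := fun x hx y hy hxy => by
    have := hu.min_le_of_mem_Icc hm ⟨hm.1.trans hy.1, hy.2⟩ ⟨hx.1, hxy⟩
    rw [min_eq_right (hmax ⟨hm.1.trans hy.1, hy.2⟩)] at this
    exact neg_le_neg this
  have b1 : BoundedVariationOn u (Icc 0 m) :=
    h1.boundedVariationOn fun x hx => hC x ⟨hx.1, hx.2.trans hm.2⟩
  have b2 : BoundedVariationOn (-u) (Icc m 1) :=
    h2.boundedVariationOn (C := C) fun x hx => by
      simpa using hC x ⟨hm.1.trans hx.1, hx.2⟩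
  have b2' : BoundedVariationOn u (Icc m 1) := by
    have := (LipschitzWith.id (α := ℝ)).neg.comp_boundedVariationOn b2
    simpa [Function.comp_def] using this
  rw [BoundedVariationOn, ← Icc_union_Icc_eq_Icc hm.1 hm.2,
    eVariationOn.union u (isGreatest_Icc hm.1) (isLeast_Icc hm.2)]
  exact ENNReal.add_ne_top.2 ⟨b1, b2'⟩

lemma isDistortion_of_concaveOn (hu : ConcaveOn ℝ (Icc 0 1) u) (hc : ContinuousOn u (Icc 0 1))
    (h0 : u 0 = 0) : IsDistortion u where
  boundedVariation := boundedVariationOn_of_concaveOn hu hc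
  map_zero := h0
  tendsto_zero := by
    have := (hc 0 (by simp)).mono_left (nhdsWithin_le_of_mem (Icc_mem_nhdsGT zero_lt_one))
    rwa [h0] at this
  tendsto_one := (hc 1 (by simp)).mono_left (nhdsWithin_le_of_mem (Icc_mem_nhdsLT zero_lt_one))

/-- The common lower bound `l` keeps `sInf` away from its default value `0` on sets that are
unbounded below. -/
lemma concaveOn_sInf {D : Set ℝ} (hD : Convex ℝ D) {S : Set (ℝ → ℝ)} (hS : S.Nonempty)
    (hconc : ∀ h ∈ S, ConcaveOn ℝ D h) {l : ℝ → ℝ} (hl : ∀ h ∈ S, ∀ t ∈ D, l t ≤ h t) :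
    ConcaveOn ℝ D fun t => sInf {y | ∃ h ∈ S, y = h t} := by
  refine ⟨hD, fun x hx y hy a b ha hb hab => ?_⟩
  have hbdd : ∀ t ∈ D, BddBelow {y | ∃ h ∈ S, y = h t} := fun t ht =>
    ⟨l t, by rintro _ ⟨h, hh, rfl⟩; exact hl h hh t ht⟩
  obtain ⟨h₀, hh₀⟩ := hS
  refine le_csInf ⟨_, h₀, hh₀, rfl⟩ ?_
  rintro _ ⟨h, hh, rfl⟩
  refine le_trans ?_ ((hconc h hh).2 hx hy ha hb hab)
  simp only [smul_eq_mul]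
  exact add_le_add (mul_le_mul_of_nonneg_left (csInf_le (hbdd x hx) ⟨h, hh, rfl⟩) ha)
    (mul_le_mul_of_nonneg_left (csInf_le (hbdd y hy) ⟨h, hh, rfl⟩) hb)

end Concave

/-- The regularity of a distortion function which the theory of its concave envelope uses. -/
structure IsRegular (g : ℝ → ℝ) : Prop where
  bounded : ∃ M, ∀ t ∈ Icc (0 : ℝ) 1, |g t| ≤ M
  map_zero : g 0 = 0
  tendsto_zero : Tendsto g (𝓝[>] 0) (𝓝 0)
  tendsto_one : Tendsto g (𝓝[<] 1) (𝓝 (g 1))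
  usc : ∀ s ∈ Ioo (0 : ℝ) 1, ∀ y, g s < y → ∀ᶠ t in 𝓝 s, g t < y

/-- Bounded variation of `g` enters the argument only here. It makes the one-sided limits exist, so
that `leftLim` and `rightLim` are genuine limits. The resulting properties survive the addition of a
continuous tilt. -/
lemma IsDistortion.isRegular {g : ℝ → ℝ} (hg : IsDistortion g)
    (husc : ∀ x ∈ Icc (0 : ℝ) 1, g x = uscVersion g x) : IsRegular g where
  bounded := by
    refine ⟨(eVariationOn g (Icc 0 1)).toReal, fun t ht => ?_⟩
    have h1 := hg.boundedVariation.dist_le ht (left_mem_Icc.2 zero_le_one)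
    rwa [Real.dist_eq, hg.map_zero, sub_zero] at h1
  map_zero := hg.map_zero
  tendsto_zero := hg.tendsto_zero
  tendsto_one := hg.tendsto_one
  usc := by
    intro s hs y hy
    have hsval := husc s ⟨hs.1.le, hs.2.le⟩
    rw [uscVersion, if_pos hs] at hsval
    have hl : Function.leftLim g s ≤ g s := by
      conv_rhs => rw [hsval]
      exact (le_max_left _ _).trans (le_max_left _ _)
    have hr : Function.rightLim g s ≤ g s := by
      conv_rhs => rw [hsval]
      exact le_max_right _ _
    obtain ⟨a, ha⟩ := hg.boundedVariation.exists_tendsto_left s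
    obtain ⟨b, hb⟩ := hg.boundedVariation.exists_tendsto_right s
    have hI : Icc (0 : ℝ) 1 ∈ 𝓝 s := Icc_mem_nhds hs.1 hs.2
    rw [nhdsWithin_inter_of_mem (mem_nhdsWithin_of_mem_nhds hI)] at ha hb
    rw [leftLim_eq_of_tendsto ha] at hl
    rw [rightLim_eq_of_tendsto hb] at hr
    have h1 := ha.eventually (gt_mem_nhds (hl.trans_lt hy))
    have h2 := hb.eventually (gt_mem_nhds (hr.trans_lt hy))
    rw [← nhdsLT_sup_nhdsGE, ← Ioi_insert, nhdsWithin_insert]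
    exact eventually_sup.2 ⟨h1, eventually_sup.2 ⟨hy, h2⟩⟩

/-! ### The concave envelope and its contact set -/

section Envelope

variable {g : ℝ → ℝ}

lemma IsRegular.continuousWithinAt (hg : IsRegular g) {e : ℝ} (he : e = 0 ∨ e = 1) :
    ContinuousWithinAt g (Icc 0 1) e := by
  rcases he with rfl | rfl
  · have h : ContinuousWithinAt g (Ioi 0) 0 := by
      rw [ContinuousWithinAt, hg.map_zero]
      exact hg.tendsto_zero
    exact (continuousWithinAt_Ioi_iff_Ici.1 h).mono Icc_subset_Ici_self
  · exact (continuousWithinAt_Iio_iff_Iic.1 hg.tendsto_one).mono Icc_subset_Iic_self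

lemma IsRegular.exists_affine_bound (hg : IsRegular g) {e : ℝ} (he : e = 0 ∨ e = 1) {η : ℝ}
    (hη : 0 < η) : ∃ K, ∀ s ∈ Icc (0 : ℝ) 1, g s ≤ g e + η + K * |s - e| := by
  obtain ⟨M, hM⟩ := hg.bounded
  have heI : e ∈ Icc (0 : ℝ) 1 := by rcases he with rfl | rfl <;> simp
  obtain ⟨δ, hδ, h⟩ := Metric.continuousWithinAt_iff.1 (hg.continuousWithinAt he) η hη
  have hM0 : 0 ≤ M := (abs_nonneg _).trans (hM e heI)
  -- Within distance `δ` of `e` continuity suffices; beyond it a slope of `2 * M / δ` outweighs the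
  -- oscillation, which is at most `2 * M`.
  refine ⟨2 * M / δ, fun s hs => ?_⟩
  by_cases hd : |s - e| < δ
  · have h1 := (abs_lt.1 (h hs hd)).2
    have h2 : 0 ≤ 2 * M / δ * |s - e| := by positivity
    linarith
  · have h1 : 2 * M ≤ 2 * M / δ * |s - e| := by
      rw [div_mul_eq_mul_div, le_div_iff₀ hδ]
      exact mul_le_mul_of_nonneg_left (not_lt.1 hd) (by positivity)
    linarith [(abs_le.1 (hM s hs)).2, (abs_le.1 (hM e heI)).1]

/-- A concave function that lies between `g` and every affine majorant of `g`. -/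
structure IsTightMajorant (g u : ℝ → ℝ) : Prop where
  concaveOn : ConcaveOn ℝ (Icc 0 1) u
  le : ∀ t ∈ Icc (0 : ℝ) 1, g t ≤ u t
  le_affine : ∀ a b : ℝ, (∀ s ∈ Icc (0 : ℝ) 1, g s ≤ a + b * s) →
    ∀ t ∈ Icc (0 : ℝ) 1, u t ≤ a + b * t

namespace IsTightMajorant

variable {u : ℝ → ℝ}

lemma le_bound (hu : IsTightMajorant g u) {e : ℝ} (he : e = 0 ∨ e = 1) {c K : ℝ}
    (h : ∀ s ∈ Icc (0 : ℝ) 1, g s ≤ c + K * |s - e|) :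
    ∀ t ∈ Icc (0 : ℝ) 1, u t ≤ c + K * |t - e| := by
  rcases he with rfl | rfl
  · intro t ht
    have := hu.le_affine c K (fun s hs => by simpa [abs_of_nonneg hs.1] using h s hs) t ht
    simpa [abs_of_nonneg ht.1] using this
  · have hab : ∀ s ∈ Icc (0 : ℝ) 1, c + K * |s - 1| = (c + K) + (-K) * s := fun s hs => by
      rw [abs_of_nonpos (by linarith [hs.2])]; ring
    intro t ht
    rw [hab t ht]
    exact hu.le_affine _ _ (fun s hs => by rw [← hab s hs]; exact h s hs) t ht

lemma eq_endpoint (hg : IsRegular g) (hu : IsTightMajorant g u) {e : ℝ} (he : e = 0 ∨ e = 1) :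
    u e = g e := by
  have heI : e ∈ Icc (0 : ℝ) 1 := by rcases he with rfl | rfl <;> simp
  refine le_antisymm (le_of_forall_pos_le_add fun η hη => ?_) (hu.le e heI)
  obtain ⟨K, hK⟩ := hg.exists_affine_bound he hη
  simpa using hu.le_bound he hK e heI

/-- Only the end points matter. There the function is squeezed between the chord over `[0,1]` and
the steep affine majorants. -/
lemma continuousOn (hg : IsRegular g) (hu : IsTightMajorant g u) :
    ContinuousOn u (Icc 0 1) := by
  have hend : ∀ e : ℝ, e = 0 ∨ e = 1 → ContinuousWithinAt u (Icc 0 1) e := by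
    intro e he
    have hlow : ∀ s ∈ Icc (0 : ℝ) 1, (1 - s) * u 0 + s * u 1 ≤ u s := fun s hs => by
      have := hu.concaveOn.2 (left_mem_Icc.2 zero_le_one) (right_mem_Icc.2 zero_le_one)
        (sub_nonneg.2 hs.2) hs.1 (by ring)
      simpa using this
    refine tendsto_order.2 ⟨fun a ha => ?_, fun a ha => ?_⟩
    · have hc : Tendsto (fun s => (1 - s) * u 0 + s * u 1) (𝓝[Icc 0 1] e) (𝓝 (u e)) := by
        have : ContinuousAt (fun s : ℝ => (1 - s) * u 0 + s * u 1) e := by fun_prop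
        have h2 := this.tendsto.mono_left (nhdsWithin_le_nhds (s := Icc 0 1))
        have h3 : (1 - e) * u 0 + e * u 1 = u e := by rcases he with rfl | rfl <;> simp
        rwa [h3] at h2
      filter_upwards [hc.eventually (lt_mem_nhds ha), self_mem_nhdsWithin] with s h1 h2
      exact h1.trans_le (hlow s h2)
    · obtain ⟨K, hK⟩ := hg.exists_affine_bound he (half_pos (sub_pos.2 ha))
      have hc : Tendsto (fun s => g e + (a - u e) / 2 + K * |s - e|) (𝓝[Icc 0 1] e)
          (𝓝 (g e + (a - u e) / 2)) := by
        have : ContinuousAt (fun s : ℝ => g e + (a - u e) / 2 + K * |s - e|) e := by fun_prop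
        have h2 := this.tendsto.mono_left (nhdsWithin_le_nhds (s := Icc 0 1))
        simpa using h2
      have hlt : g e + (a - u e) / 2 < a := by
        rw [← hu.eq_endpoint hg he]; linarith
      filter_upwards [hc.eventually (gt_mem_nhds hlt), self_mem_nhdsWithin] with s h1 h2
      exact (hu.le_bound he hK s h2).trans_lt h1
  intro t ht
  rcases eq_or_lt_of_le ht.1 with h0 | h0
  · exact hend t (Or.inl h0.symm)
  rcases eq_or_lt_of_le ht.2 with h1 | h1
  · exact hend t (Or.inr h1)
  · exact (continuousAt_of_concaveOn hu.concaveOn ⟨h0, h1⟩).continuousWithinAt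

end IsTightMajorant

/-- An affine majorant need not vanish at `0`, so it may fail to compete in `concaveEnv`. The
infimum of all of them does compete: it shows that the competing class is nonempty and passes every
affine bound on to `concaveEnv`. -/
lemma IsRegular.isTightMajorant_affineEnv (hg : IsRegular g) :
    IsTightMajorant g fun t => sInf {y | ∃ h ∈ {h : ℝ → ℝ | ∃ a b : ℝ, h = (fun s => a + b * s) ∧
      ∀ s ∈ Icc (0 : ℝ) 1, g s ≤ h s}, y = h t} := by
  obtain ⟨M, hM⟩ := hg.bounded
  have hne : (fun s : ℝ => M + 0 * s) ∈ {h : ℝ → ℝ | ∃ a b : ℝ, h = (fun s => a + b * s) ∧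
      ∀ s ∈ Icc (0 : ℝ) 1, g s ≤ h s} :=
    ⟨M, 0, rfl, fun s hs => by simpa using (abs_le.1 (hM s hs)).2⟩
  have hge : ∀ h ∈ {h : ℝ → ℝ | ∃ a b : ℝ, h = (fun s => a + b * s) ∧
      ∀ s ∈ Icc (0 : ℝ) 1, g s ≤ h s}, ∀ t ∈ Icc (0 : ℝ) 1, g t ≤ h t := by
    rintro h ⟨a, b, -, hh⟩; exact hh
  refine ⟨concaveOn_sInf (convex_Icc 0 1) ⟨_, hne⟩ ?_ hge, fun t ht => ?_, fun a b hab t ht => ?_⟩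
  · rintro _ ⟨a, b, rfl, -⟩
    refine ⟨convex_Icc 0 1, fun x _ y _ c d _ _ hcd => le_of_eq ?_⟩
    simp only [smul_eq_mul]
    linear_combination a * hcd
  · refine le_csInf ⟨_, _, hne, rfl⟩ ?_
    rintro _ ⟨h, hh, rfl⟩
    exact hge h hh t ht
  · refine csInf_le ⟨g t, ?_⟩ ⟨_, ⟨a, b, rfl, hab⟩, rfl⟩
    rintro _ ⟨h, hh, rfl⟩
    exact hge h hh t ht

lemma concaveEnv_le {h : ℝ → ℝ} (hh : ConcaveOn ℝ (Icc 0 1) h) (hc : ContinuousOn h (Icc 0 1))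
    (h0 : h 0 = 0) (hgh : ∀ s ∈ Icc (0 : ℝ) 1, g s ≤ h s) {t : ℝ} (ht : t ∈ Icc (0 : ℝ) 1) :
    concaveEnv g t ≤ h t := by
  refine csInf_le ⟨g t, ?_⟩ ⟨h, isDistortion_of_concaveOn hh hc h0, hh, hgh, rfl⟩
  rintro _ ⟨k, -, -, hk, rfl⟩
  exact hk t ht

lemma IsRegular.isTightMajorant_concaveEnv (hg : IsRegular g) :
    IsTightMajorant g (concaveEnv g) := by
  have hA := hg.isTightMajorant_affineEnv
  have hA0 := (hA.eq_endpoint hg (Or.inl rfl)).trans hg.map_zero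
  have hAc := hA.continuousOn hg
  have heq : concaveEnv g = fun t => sInf {y | ∃ h ∈ {h : ℝ → ℝ | IsDistortion h ∧
      ConcaveOn ℝ (Icc 0 1) h ∧ ∀ s ∈ Icc (0 : ℝ) 1, g s ≤ h s}, y = h t} := by
    ext t; simp only [concaveEnv, mem_ofPred_eq, and_assoc]
  have hmem := isDistortion_of_concaveOn hA.concaveOn hAc hA0
  refine ⟨?_, fun t ht => ?_, fun a b hab t ht =>
    (concaveEnv_le hA.concaveOn hAc hA0 hA.le ht).trans (hA.le_affine a b hab t ht)⟩
  · rw [heq]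
    exact concaveOn_sInf (convex_Icc 0 1) ⟨_, hmem, hA.concaveOn, hA.le⟩
      (fun h hh => hh.2.1) (fun h hh => hh.2.2)
  · rw [heq]
    refine le_csInf ⟨_, _, ⟨hmem, hA.concaveOn, hA.le⟩, rfl⟩ ?_
    rintro _ ⟨h, hh, rfl⟩
    exact hh.2.2 t ht

namespace IsRegular

lemma concaveOn_env (hg : IsRegular g) : ConcaveOn ℝ (Icc 0 1) (concaveEnv g) :=
  hg.isTightMajorant_concaveEnv.concaveOn

lemma le_env (hg : IsRegular g) {t : ℝ} (ht : t ∈ Icc (0 : ℝ) 1) : g t ≤ concaveEnv g t :=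
  hg.isTightMajorant_concaveEnv.le t ht

lemma env_zero (hg : IsRegular g) : concaveEnv g 0 = 0 :=
  (hg.isTightMajorant_concaveEnv.eq_endpoint hg (Or.inl rfl)).trans hg.map_zero

lemma env_one (hg : IsRegular g) : concaveEnv g 1 = g 1 :=
  hg.isTightMajorant_concaveEnv.eq_endpoint hg (Or.inr rfl)

lemma continuousOn_env (hg : IsRegular g) : ContinuousOn (concaveEnv g) (Icc 0 1) :=
  hg.isTightMajorant_concaveEnv.continuousOn hg

lemma env_eq_integral (hg : IsRegular g) {t : ℝ} (ht : t ∈ Icc (0 : ℝ) 1) :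
    concaveEnv g t = ∫ s in (0 : ℝ)..t, rightDeriv (concaveEnv g) s :=
  eq_integral_rightDeriv hg.concaveOn_env hg.continuousOn_env hg.env_zero ht

lemma integrable_env (hg : IsRegular g) : Integrable (rightDeriv (concaveEnv g)) unif :=
  integrable_rightDeriv hg.concaveOn_env hg.continuousOn_env

lemma integral_env (hg : IsRegular g) : ∫ t, rightDeriv (concaveEnv g) t ∂unif = g 1 := by
  rw [← hg.env_one, hg.env_eq_integral (right_mem_Icc.2 zero_le_one),
    intervalIntegral.integral_of_le zero_le_one, integral_Ioc_eq_integral_Ioo, unif]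

end IsRegular

/-- The chord of a concave function lies above it outside of the interval, and below it inside. -/
lemma chord_comparison {u : ℝ → ℝ} (hu : ConcaveOn ℝ (Icc 0 1) u) {a b : ℝ} (ha : 0 < a)
    (hab : a < b) (hb : b < 1) :
    (∀ t ∈ Icc (0 : ℝ) 1, t ∉ Ioo a b → u t ≤ u a + slope u a b * (t - a)) ∧
      ∀ t ∈ Icc a b, u a + slope u a b * (t - a) ≤ u t := by
  have hk : slope u a b = (u b - u a) / (b - a) := slope_def_field u a b
  have hba : 0 < b - a := sub_pos.2 hab
  have hub : u b = u a + slope u a b * (b - a) := by rw [hk]; field_simp; ring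
  constructor
  · intro t ht hnot
    rcases lt_trichotomy t a with h | rfl | h
    · have := hu.slope_anti_adjacent ht ⟨ha.le.trans hab.le, hb.le⟩ h hab
      rw [← hk, le_div_iff₀ (sub_pos.2 h)] at this
      linarith
    · simp
    · have hbt : b ≤ t := by
        by_contra! h2; exact hnot ⟨h, h2⟩
      rcases eq_or_lt_of_le hbt with rfl | hbt
      · exact hub.le
      have := hu.slope_anti_adjacent ⟨ha.le, hab.le.trans hb.le⟩ ht hab hbt
      rw [← hk, div_le_iff₀ (sub_pos.2 hbt)] at this
      linarith
  · intro t ht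
    rcases eq_or_lt_of_le ht.1 with rfl | h1
    · simp
    rcases eq_or_lt_of_le ht.2 with rfl | h2
    · exact hub.ge
    have := hu.slope_anti_adjacent ⟨ha.le, hab.le.trans hb.le⟩
      ⟨ha.le.trans hab.le, hb.le⟩ h1 h2
    rw [div_le_div_iff₀ (sub_pos.2 h2) (sub_pos.2 h1), hub] at this
    have h3 : (u a + slope u a b * (t - a) - u t) * (b - a) ≤ 0 := by nlinarith
    nlinarith

/-- By semicontinuity some level `m` separates `g` from its envelope near `s`. The chord of the
envelope over a short interval stays above `m`, hence above `g`, so the minimum of the envelope and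
the chord line is an admissible majorant. Minimality makes the envelope equal to the chord there. -/
lemma IsRegular.rightDeriv_env_locally_const (hg : IsRegular g) {s : ℝ}
    (hs : s ∈ Ioo (0 : ℝ) 1) (hlt : g s < concaveEnv g s) :
    ∃ a b c : ℝ, 0 < a ∧ a < s ∧ s < b ∧ b < 1 ∧
      ∀ t ∈ Ioo a b, rightDeriv (concaveEnv g) t = c := by
  set u := concaveEnv g with hu
  have hconc : ConcaveOn ℝ (Icc 0 1) u := hg.concaveOn_env
  obtain ⟨m, hm1, hm2⟩ := exists_between hlt
  have hev : ∀ᶠ t in 𝓝 s, g t < m ∧ m < u t ∧ t ∈ Ioo (0 : ℝ) 1 :=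
    (hg.usc s hs m hm1).and (((continuousAt_of_concaveOn hconc hs).eventually
      (lt_mem_nhds hm2)).and (Ioo_mem_nhds hs.1 hs.2))
  obtain ⟨a', b', hab', hsub⟩ := mem_nhds_iff_exists_Ioo_subset.1 hev
  obtain ⟨a, ha1, ha2⟩ := exists_between hab'.1
  obtain ⟨b, hb1, hb2⟩ := exists_between hab'.2
  have hin : ∀ t ∈ Icc a b, g t < m ∧ m < u t ∧ t ∈ Ioo (0 : ℝ) 1 := fun t ht =>
    hsub ⟨ha1.trans_le ht.1, ht.2.trans_lt hb2⟩
  have hab : a < b := ha2.trans hb1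
  have ha := hin a (left_mem_Icc.2 hab.le)
  have hb := hin b (right_mem_Icc.2 hab.le)
  obtain ⟨hout, hins⟩ := chord_comparison hconc ha.2.2.1 hab hb.2.2.2
  set l : ℝ → ℝ := fun t => u a + slope u a b * (t - a) with hl
  have hlconc : ConcaveOn ℝ (Icc 0 1) l := by
    refine ⟨convex_Icc 0 1, fun x _ y _ c d _ _ hcd => le_of_eq ?_⟩
    simp only [hl, smul_eq_mul]
    linear_combination (u a - slope u a b * a) * hcd
  have hlab : ∀ t ∈ Icc a b, m < l t := by
    intro t ht
    have h := hlconc.min_le_of_mem_Icc ⟨ha.2.2.1.le, ha.2.2.2.le⟩ ⟨hb.2.2.1.le, hb.2.2.2.le⟩ ht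
    have hla : l a = u a := by simp [hl]
    have hlb : l b = u b := by
      simp only [hl, slope_def_field]; field_simp [(sub_pos.2 hab).ne']; ring
    rw [hla, hlb] at h
    exact (lt_min ha.2.1 hb.2.1).trans_le h
  have hle : ∀ t ∈ Icc (0 : ℝ) 1, u t ≤ (u ⊓ l) t := by
    intro t ht
    refine concaveEnv_le (hconc.inf hlconc)
      (hg.continuousOn_env.inf (by fun_prop)) ?_ (fun r hr => ?_) ht
    · have h0 : u 0 ≤ l 0 := hout 0 (by simp) fun h => absurd h.1 (not_lt.2 ha.2.2.1.le)
      rw [Pi.inf_apply, inf_eq_left.2 h0]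
      exact hg.env_zero
    · refine le_inf (hg.le_env hr) ?_
      by_cases hrr : r ∈ Ioo a b
      · exact ((hin r ⟨hrr.1.le, hrr.2.le⟩).1.trans (hlab r ⟨hrr.1.le, hrr.2.le⟩)).le
      · exact (hg.le_env hr).trans (hout r hr hrr)
  refine ⟨a, b, slope u a b, ha.2.2.1, ha2, hb1, hb.2.2.2, fun t ht => ?_⟩
  have heq : u =ᶠ[𝓝 t] l := by
    filter_upwards [Ioo_mem_nhds ht.1 ht.2] with r hr
    have hr' : r ∈ Icc a b := ⟨hr.1.le, hr.2.le⟩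
    have h01 := (hin r hr').2.2
    exact le_antisymm ((hle r ⟨h01.1.le, h01.2.le⟩).trans inf_le_right) (hins r hr')
  rw [rightDeriv, (heq.filter_mono nhdsWithin_le_nhds).derivWithin_eq heq.self_of_nhds]
  have : HasDerivAt l (slope u a b) t := by
    have h := (((hasDerivAt_id t).sub_const a).const_mul (slope u a b)).const_add (u a)
    rw [mul_one] at h
    exact h
  exact this.hasDerivWithinAt.derivWithin (uniqueDiffWithinAt_Ioi t)

/-- Where the quantile function is an increasing affine image of the derivative of the concave
envelope, the distortion function agrees with its envelope. -/
lemma IsRegular.env_eq_of_quantile (hg : IsRegular g) {A B : ℝ} {G : Measure ℝ}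
    (hq : IsQuantileOf (fun p => A + B * rightDeriv (concaveEnv g) (1 - p)) G) (x : ℝ) :
    g (1 - cdf G x) = concaveEnv g (1 - cdf G x) := by
  have h0 := cdf_nonneg G x
  have h1 := cdf_le_one G x
  rcases eq_or_lt_of_le h0 with h0 | h0
  · rw [← h0, sub_zero, hg.env_one]
  rcases eq_or_lt_of_le h1 with h1 | h1
  · rw [h1, sub_self, hg.env_zero, hg.map_zero]
  by_contra hne
  have hs : 1 - cdf G x ∈ Ioo (0 : ℝ) 1 := ⟨by linarith, by linarith⟩
  obtain ⟨a, b, c, ha, has, hsb, hb, hconst⟩ := hg.rightDeriv_env_locally_const hs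
    (lt_of_le_of_ne (hg.le_env ⟨hs.1.le, hs.2.le⟩) hne)
  have hq1 := (hq _ ⟨h0, h1⟩ x).2 le_rfl
  -- The quantile function is flat around the level `cdf G x`, so a slightly larger level `p` still
  -- has quantile at most `x`; this forces `p ≤ cdf G x`.
  obtain ⟨p, hp1, hp2⟩ := exists_between (show cdf G x < 1 - a by linarith)
  have hq2 := (hq p ⟨h0.trans hp1, by linarith⟩ x).1 (by
    simp only [hconst _ ⟨has, hsb⟩] at hq1
    simpa only [hconst (1 - p) ⟨by linarith, by linarith⟩] using hq1)
  linarith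

end Envelope

/-! ### Primitives, truncation and square integrability -/

section Primitive

lemma continuousOn_primitive {w : ℝ → ℝ} (hw : Integrable w unif) :
    ContinuousOn (fun t => ∫ s in (0 : ℝ)..t, w s) (Icc 0 1) := by
  have h : IntegrableOn w (uIcc 0 1) := by
    rw [uIcc_of_le zero_le_one, integrableOn_Icc_iff_integrableOn_Ioo]; exact hw
  have := intervalIntegral.continuousOn_primitive_interval h
  rwa [uIcc_of_le zero_le_one] at this

lemma concaveOn_primitive {w : ℝ → ℝ} (hw : Integrable w unif) (ha : AntitoneOn w (Ioo 0 1)) :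
    ConcaveOn ℝ (Icc 0 1) fun t => ∫ s in (0 : ℝ)..t, w s := by
  refine concaveOn_of_slope_anti_adjacent (convex_Icc 0 1) fun {x y z} hx hz hxy hyz => ?_
  have hy : y ∈ Ioo (0 : ℝ) 1 := ⟨hx.1.trans_lt hxy, hyz.trans_le hz.2⟩
  have hyI : y ∈ Icc (0 : ℝ) 1 := ⟨hy.1.le, hy.2.le⟩
  have h0 : (0 : ℝ) ∈ Icc (0 : ℝ) 1 := by simp
  rw [intervalIntegral.integral_interval_sub_left (intervalIntegrable_of_unif hw h0 hz)
    (intervalIntegrable_of_unif hw h0 hyI),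
    intervalIntegral.integral_interval_sub_left (intervalIntegrable_of_unif hw h0 hyI)
    (intervalIntegrable_of_unif hw h0 hx)]
  have h1 : ∫ s in y..z, w s ≤ ∫ _ in y..z, w y :=
    intervalIntegral.integral_mono_on_of_le_Ioo hyz.le (intervalIntegrable_of_unif hw hyI hz)
      (by simp) fun s hs => ha hy ⟨hy.1.trans hs.1, hs.2.trans_le hz.2⟩ hs.1.le
  have h2 : ∫ _ in x..y, w y ≤ ∫ s in x..y, w s :=
    intervalIntegral.integral_mono_on_of_le_Ioo hxy.le (by simp)
      (intervalIntegrable_of_unif hw hx hyI)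
      fun s hs => ha ⟨hx.1.trans_lt hs.1, hs.2.trans hy.2⟩ hy hs.2.le
  simp only [intervalIntegral.integral_const, smul_eq_mul] at h1 h2
  calc _ ≤ w y := by rw [div_le_iff₀ (sub_pos.2 hyz)]; linarith
    _ ≤ _ := by rw [le_div_iff₀ (sub_pos.2 hxy)]; linarith

end Primitive

/-- Reflection turns antitone and right continuous into monotone and left continuous. The map `φ`
will be a truncation or an affine map. -/
lemma isQuantileOf_rightDeriv {u φ : ℝ → ℝ} (hu : ConcaveOn ℝ (Icc 0 1) u) (hφ : Monotone φ)
    (hc : Continuous φ) :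
    IsQuantileOf (fun t => φ (rightDeriv u (1 - t)))
      (unif.map fun t => φ (rightDeriv u (1 - t))) := by
  refine isQuantileOf_map (fun x hx y hy hxy => hφ ?_) fun p hp => ?_
  · exact antitoneOn_rightDeriv hu ⟨by linarith [hy.2], by linarith [hy.1]⟩
      ⟨by linarith [hx.2], by linarith [hx.1]⟩ (by linarith)
  · have h1 : Tendsto (fun t : ℝ => 1 - t) (𝓝[<] p) (𝓝[>] (1 - p)) := by
      refine tendsto_nhdsWithin_iff.2 ⟨?_, ?_⟩
      · exact ((continuous_const.sub continuous_id).tendsto p).mono_left nhdsWithin_le_nhds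
      · filter_upwards [self_mem_nhdsWithin] with t ht
        simpa using ht
    exact (hc.tendsto _).comp ((tendsto_rightDeriv hu (t := 1 - p)
      ⟨by linarith [hp.2], by linarith [hp.1]⟩).comp h1)

/-- Truncation at levels `-N` and `N`. -/
def clamp (N x : ℝ) : ℝ := max (-N) (min N x)

lemma monotone_clamp (N : ℝ) : Monotone (clamp N) := fun _ _ h =>
  max_le_max le_rfl (min_le_min le_rfl h)

lemma continuous_clamp (N : ℝ) : Continuous (clamp N) := by
  unfold clamp; fun_prop

lemma abs_clamp_le {N : ℝ} (hN : 0 ≤ N) (x : ℝ) : |clamp N x| ≤ N :=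
  abs_le.2 ⟨le_max_left _ _, max_le (by linarith) (min_le_left _ _)⟩

lemma clamp_of_abs_le {N x : ℝ} (h : |x| ≤ N) : clamp N x = x := by
  rw [clamp, min_eq_right (abs_le.1 h).2, max_eq_right (abs_le.1 h).1]

lemma clamp_sq_le {N : ℝ} (hN : 0 ≤ N) (x : ℝ) : clamp N x ^ 2 ≤ clamp N x * x := by
  unfold clamp
  rcases le_total N x with h | h
  · rw [min_eq_left h, max_eq_right (by linarith)]; nlinarith
  · rw [min_eq_right h]
    rcases le_total x (-N) with h' | h'
    · rw [max_eq_left h']; nlinarith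
    · rw [max_eq_right h']; nlinarith

lemma abs_clamp_le_abs {N : ℝ} (hN : 0 ≤ N) (x : ℝ) : |clamp N x| ≤ |x| := by
  have h := clamp_sq_le hN x
  by_contra! hlt
  have h2 : clamp N x * x ≤ |clamp N x| * |x| := by rw [← abs_mul]; exact le_abs_self _
  have h3 := sq_abs (clamp N x)
  nlinarith [abs_nonneg x]

lemma eventually_clamp_eq (x : ℝ) : ∀ᶠ n : ℕ in atTop, clamp n x = x := by
  filter_upwards [tendsto_natCast_atTop_atTop.eventually (eventually_ge_atTop |x|)] with n hn
  exact clamp_of_abs_le hn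

lemma memLp_clamp_comp {q : ℝ → ℝ} (hq : AEMeasurable q unif) {N : ℝ} (hN : 0 ≤ N) :
    MemLp (fun t => clamp N (q t)) 2 unif :=
  MemLp.of_bound ((continuous_clamp N).comp_aestronglyMeasurable hq.aestronglyMeasurable) N
    (Eventually.of_forall fun _ => abs_clamp_le hN _)

lemma integrable_mul_of_memLp {X Y : ℝ → ℝ} (hX : MemLp X 2 unif) (hY : MemLp Y 2 unif) :
    Integrable (fun t => X t * Y t) unif :=
  hX.integrable_mul hY

lemma integrable_of_memLp {X : ℝ → ℝ} (hX : MemLp X 2 unif) : Integrable X unif :=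
  hX.integrable one_le_two

/-- The derivative of a concave function inherits square integrability from a majorant with the
same end points. -/
lemma memLp_rightDeriv_of_le {u v w : ℝ → ℝ} (hu : ConcaveOn ℝ (Icc 0 1) u)
    (hc : ContinuousOn u (Icc 0 1)) (h0 : u 0 = 0) (hw : MemLp w 2 unif)
    (hv : ∀ t ∈ Icc (0 : ℝ) 1, v t = ∫ s in (0 : ℝ)..t, w s)
    (huv : ∀ t ∈ Icc (0 : ℝ) 1, u t ≤ v t) (h1 : u 1 = v 1) : MemLp (rightDeriv u) 2 unif := by
  set p := fun t => rightDeriv u (1 - t) with hp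
  have hui := integrable_rightDeriv hu hc
  have hpi : Integrable p unif := integrable_comp_one_sub hui
  have hw' := memLp_comp_one_sub hw
  -- Testing `ρ_u ≤ ρ_v` with the law whose quantile function is the truncated `p` gives `∫
  -- clamp(p)² ≤ ∫ clamp(p) p ≤ ∫ clamp(p) w(1-·)`. Young's inequality absorbs half of the left
  -- side, which leaves a bound free of `n`.
  have hbound : ∀ n : ℕ, ∫ t, clamp n (p t) ^ 2 ∂unif ≤ ∫ t, w (1 - t) ^ 2 ∂unif := by
    intro n
    have hn : (0 : ℝ) ≤ n := n.cast_nonneg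
    have hQ := isQuantileOf_rightDeriv hu (monotone_clamp n) (continuous_clamp n)
    have hcl := memLp_clamp_comp hpi.aemeasurable hn
    have hi1 : Integrable (fun t => clamp n (p t) * p t) unif :=
      hpi.bdd_mul hcl.aestronglyMeasurable (Eventually.of_forall fun t => abs_clamp_le hn _)
    have hi2 : Integrable (fun t => clamp n (p t) * w (1 - t)) unif :=
      integrable_mul_of_memLp hcl hw'
    have hle := rho_mono huv h1 (unif.map fun t => clamp n (rightDeriv u (1 - t)))
    rw [rho_eq_integral hQ hui hi1 (fun t ht => eq_integral_rightDeriv hu hc h0 ht),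
      rho_eq_integral hQ (integrable_of_memLp hw) hi2 hv, EReal.coe_le_coe_iff] at hle
    have h2 : ∫ t, clamp n (p t) ^ 2 ∂unif ≤ ∫ t, clamp n (p t) * p t ∂unif :=
      integral_mono hcl.integrable_sq hi1 fun t => clamp_sq_le hn _
    have h3 : ∫ t, 2 * (clamp n (p t) * w (1 - t)) ∂unif ≤
        ∫ t, (clamp n (p t) ^ 2 + w (1 - t) ^ 2) ∂unif :=
      integral_mono (hi2.const_mul 2) (hcl.integrable_sq.add hw'.integrable_sq)
        fun t => by nlinarith [sq_nonneg (clamp n (p t) - w (1 - t))]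
    rw [integral_const_mul, integral_add hcl.integrable_sq hw'.integrable_sq] at h3
    linarith
  have hsq : Integrable (fun t => p t ^ 2) unif := by
    refine ⟨hpi.aestronglyMeasurable.pow 2, ?_⟩
    -- Fatou's lemma removes the truncation.
    have hfatou : ∫⁻ t, ENNReal.ofReal (p t ^ 2) ∂unif ≤
        ENNReal.ofReal (∫ t, w (1 - t) ^ 2 ∂unif) := by
      have hlim : ∀ t, ENNReal.ofReal (p t ^ 2) =
          liminf (fun n : ℕ => ENNReal.ofReal (clamp n (p t) ^ 2)) atTop := fun t => by
        refine (Tendsto.liminf_eq (tendsto_const_nhds.congr' ?_)).symm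
        filter_upwards [eventually_clamp_eq (p t)] with n hn
        rw [hn]
      simp only [hlim]
      refine (lintegral_liminf_le' fun n => ?_).trans ?_
      · exact (((continuous_clamp n).measurable.comp_aemeasurable hpi.aemeasurable).pow_const
          2).ennreal_ofReal
      · refine liminf_le_of_le (by isBoundedDefault) fun b hb => ?_
        obtain ⟨n, hn⟩ := hb.exists
        refine hn.trans ?_
        rw [← ofReal_integral_eq_lintegral_ofReal
          (memLp_clamp_comp hpi.aemeasurable n.cast_nonneg).integrable_sq
          (Eventually.of_forall fun t => sq_nonneg _)]
        exact ENNReal.ofReal_le_ofReal (hbound n)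
    rw [hasFiniteIntegral_iff_ofReal (Eventually.of_forall fun t => sq_nonneg _)]
    exact hfatou.trans_lt ENNReal.ofReal_lt_top
  have hp2 : MemLp p 2 unif := (memLp_two_iff_integrable_sq hpi.aestronglyMeasurable).2 hsq
  simpa [hp] using memLp_comp_one_sub hp2

/-! ### Tilted distortion functions and duality -/

section Tilt

variable {g : ℝ → ℝ} {F : Measure ℝ}

lemma IsM2.memLp_quantile (hF : IsM2 F) : MemLp (quantile F) 2 unif := by
  have := hF.1
  exact (isQuantileOf_quantile F).memLp_iff.1 hF.2

lemma IsM2.monotoneOn_quantile (hF : IsM2 F) : MonotoneOn (quantile F) (Ioo 0 1) := by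
  have := hF.1
  exact (isQuantileOf_quantile F).monotoneOn

lemma tilt_eq (g : ℝ → ℝ) (F : Measure ℝ) (lam t : ℝ) :
    tilt g F lam t = g t + lam * ∫ s in (0 : ℝ)..t, quantile F (1 - s) := by
  rw [tilt, intervalIntegral.integral_comp_sub_left (quantile F) 1, sub_zero]

lemma tilt_zero (g : ℝ → ℝ) (F : Measure ℝ) : tilt g F 0 = g := by
  ext t; simp [tilt]

lemma envDeriv_zero (g : ℝ → ℝ) (F : Measure ℝ) :
    envDeriv g F 0 = rightDeriv (concaveEnv g) := by
  rw [envDeriv, tilt_zero]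

lemma IsM2.integrable_reflect (hF : IsM2 F) : Integrable (fun s => quantile F (1 - s)) unif :=
  integrable_comp_one_sub (integrable_of_memLp hF.memLp_quantile)

lemma IsRegular.add_continuous (hg : IsRegular g) {k : ℝ → ℝ} (hk : ContinuousOn k (Icc 0 1))
    (h0 : k 0 = 0) : IsRegular fun t => g t + k t where
  bounded := by
    obtain ⟨M, hM⟩ := hg.bounded
    obtain ⟨C, hC⟩ := isCompact_Icc.exists_bound_of_continuousOn hk
    exact ⟨M + C, fun t ht => (abs_add_le _ _).trans (add_le_add (hM t ht) (hC t ht))⟩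
  map_zero := by rw [hg.map_zero, h0, add_zero]
  tendsto_zero := by
    have h := (hk 0 (by simp)).mono_left (nhdsWithin_le_of_mem (Icc_mem_nhdsGT zero_lt_one))
    simpa [h0] using hg.tendsto_zero.add h
  tendsto_one := by
    have h := (hk 1 (by simp)).mono_left (nhdsWithin_le_of_mem (Icc_mem_nhdsLT zero_lt_one))
    exact hg.tendsto_one.add h
  usc := by
    intro s hs y hy
    have hpos : 0 < (y - (g s + k s)) / 2 := by linarith
    have h1 := hg.usc s hs (g s + (y - (g s + k s)) / 2) (by linarith)
    have h2 : ∀ᶠ t in 𝓝 s, k t < k s + (y - (g s + k s)) / 2 :=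
      (hk.continuousAt (Icc_mem_nhds hs.1 hs.2)).eventually (gt_mem_nhds (by linarith))
    filter_upwards [h1, h2] with t h1 h2
    linarith

lemma isRegular_tilt (hg : IsRegular g) (hF : IsM2 F) (lam : ℝ) : IsRegular (tilt g F lam) := by
  have h := hg.add_continuous (k := fun t => lam * ∫ s in (0 : ℝ)..t, quantile F (1 - s))
    (continuousOn_const.mul (continuousOn_primitive hF.integrable_reflect)) (by simp)
  have heq : tilt g F lam = fun t => g t + lam * ∫ s in (0 : ℝ)..t, quantile F (1 - s) :=
    funext (tilt_eq g F lam)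
  rwa [heq]

lemma tilt_one (g : ℝ → ℝ) (F : Measure ℝ) (lam : ℝ) :
    tilt g F lam 1 = g 1 + lam * ∫ t, quantile F t ∂unif := by
  rw [tilt, sub_self, intervalIntegral.integral_of_le zero_le_one, integral_Ioc_eq_integral_Ioo,
    unif]

/-- The comparison function is `g*` plus the tilt. It is concave because the reflected quantile
function is antitone and `lam ≥ 0`, so it dominates the envelope of the tilted function, with equal
values at `1`. -/
lemma memLp_envDeriv (hg : IsRegular g) (hF : IsM2 F)
    (h2 : MemLp (rightDeriv (concaveEnv g)) 2 unif) {lam : ℝ} (hl : 0 ≤ lam) :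
    MemLp (envDeriv g F lam) 2 unif := by
  have hT := isRegular_tilt hg hF lam
  have hfr := hF.integrable_reflect
  have hanti : AntitoneOn (fun s => quantile F (1 - s)) (Ioo 0 1) := fun x hx y hy hxy =>
    hF.monotoneOn_quantile ⟨by linarith [hy.2], by linarith [hy.1]⟩
      ⟨by linarith [hx.2], by linarith [hx.1]⟩ (by linarith)
  have hv : ∀ t ∈ Icc (0 : ℝ) 1,
      concaveEnv g t + lam * ∫ s in (0 : ℝ)..t, quantile F (1 - s) =
      ∫ s in (0 : ℝ)..t, (rightDeriv (concaveEnv g) s + lam * quantile F (1 - s)) := by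
    intro t ht
    have h0 : (0 : ℝ) ∈ Icc (0 : ℝ) 1 := by simp
    rw [intervalIntegral.integral_add (intervalIntegrable_of_unif hg.integrable_env h0 ht)
      ((intervalIntegrable_of_unif hfr h0 ht).const_mul lam), hg.env_eq_integral ht,
      intervalIntegral.integral_const_mul]
  refine memLp_rightDeriv_of_le hT.concaveOn_env hT.continuousOn_env hT.env_zero
    (h2.add ((memLp_comp_one_sub hF.memLp_quantile).const_mul lam)) hv (fun t ht => ?_) ?_
  · refine concaveEnv_le (hg.concaveOn_env.add ((concaveOn_primitive hfr hanti).smul hl))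
      (hg.continuousOn_env.add (continuousOn_const.mul (continuousOn_primitive hfr)))
      (by simp [hg.env_zero]) (fun s hs => ?_) ht
    rw [tilt_eq]
    exact add_le_add_left (hg.le_env hs) _
  · rw [hT.env_one, tilt_eq, hg.env_one]

/-- Integrating the envelope of the tilted function and removing the tilt. -/
lemma env_tilt_sub_eq_integral (hg : IsRegular g) (hF : IsM2 F) (lam : ℝ) {t : ℝ}
    (ht : t ∈ Icc (0 : ℝ) 1) :
    concaveEnv (tilt g F lam) t - lam * ∫ s in (0 : ℝ)..t, quantile F (1 - s) =
      ∫ s in (0 : ℝ)..t, (envDeriv g F lam s - lam * quantile F (1 - s)) := by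
  have hT := isRegular_tilt hg hF lam
  have h0 : (0 : ℝ) ∈ Icc (0 : ℝ) 1 := by simp
  simp only [envDeriv]
  rw [intervalIntegral.integral_sub (intervalIntegrable_of_unif hT.integrable_env h0 ht)
    ((intervalIntegrable_of_unif hF.integrable_reflect h0 ht).const_mul lam),
    hT.env_eq_integral ht, intervalIntegral.integral_const_mul]

lemma rho_env_tilt_sub (hg : IsRegular g) (hF : IsM2 F) {lam : ℝ}
    (hP : MemLp (envDeriv g F lam) 2 unif) {q : ℝ → ℝ} {G : Measure ℝ} (hq : IsQuantileOf q G)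
    (hq2 : MemLp q 2 unif) :
    rho (fun t => concaveEnv (tilt g F lam) t - lam * ∫ s in (0 : ℝ)..t, quantile F (1 - s)) G =
      ((∫ t, q t * (envDeriv g F lam (1 - t) - lam * quantile F t) ∂unif : ℝ) : EReal) := by
  have hw : MemLp (fun s => envDeriv g F lam s - lam * quantile F (1 - s)) 2 unif :=
    hP.sub ((memLp_comp_one_sub hF.memLp_quantile).const_mul lam)
  rw [rho_eq_integral hq (integrable_of_memLp hw)
    (integrable_mul_of_memLp hq2 (memLp_comp_one_sub hw))
    (fun t ht => env_tilt_sub_eq_integral hg hF lam ht)]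
  simp only [sub_sub_cancel]

lemma env_tilt_sub_one (hg : IsRegular g) (hF : IsM2 F) (lam : ℝ) :
    g 1 = concaveEnv (tilt g F lam) 1 - lam * ∫ s in (0 : ℝ)..1, quantile F (1 - s) := by
  rw [(isRegular_tilt hg hF lam).env_one, tilt_eq]; ring

/-- Weak duality: the envelope of the tilted function minus the tilt is a majorant of `g` that has a
density and the same value at `1`. -/
lemma rho_le_integral (hg : IsRegular g) (hF : IsM2 F) {lam : ℝ}
    (hP : MemLp (envDeriv g F lam) 2 unif) {q : ℝ → ℝ} {G : Measure ℝ} (hq : IsQuantileOf q G)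
    (hq2 : MemLp q 2 unif) :
    rho g G ≤
      ((∫ t, q t * (envDeriv g F lam (1 - t) - lam * quantile F t) ∂unif : ℝ) : EReal) := by
  rw [← rho_env_tilt_sub hg hF hP hq hq2]
  refine rho_mono (fun t ht => ?_) (env_tilt_sub_one hg hF lam) G
  have := (isRegular_tilt hg hF lam).le_env ht
  rw [tilt_eq] at this
  linarith

/-- No duality gap for these laws: `1 - cdf G x` takes values only where the tilted function touches
its envelope. -/
lemma rho_eq_of_quantile (hg : IsRegular g) (hF : IsM2 F) {lam A B : ℝ}
    (hP : MemLp (envDeriv g F lam) 2 unif) {G : Measure ℝ}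
    (hq : IsQuantileOf (fun t => A + B * envDeriv g F lam (1 - t)) G)
    (hq2 : MemLp (fun t => A + B * envDeriv g F lam (1 - t)) 2 unif) :
    rho g G = ((∫ t, (A + B * envDeriv g F lam (1 - t)) *
      (envDeriv g F lam (1 - t) - lam * quantile F t) ∂unif : ℝ) : EReal) := by
  rw [← rho_env_tilt_sub hg hF hP hq hq2]
  refine rho_congr (fun x => ?_) (env_tilt_sub_one hg hF lam)
  have := (isRegular_tilt hg hF lam).env_eq_of_quantile hq x
  rw [tilt_eq] at this
  linarith

/-- Variational inequality that characterizes the envelope derivatives. -/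
lemma envDeriv_variational (hg : IsRegular g) (hF : IsM2 F) {lam lam' : ℝ}
    (hP : MemLp (envDeriv g F lam) 2 unif) (hP' : MemLp (envDeriv g F lam') 2 unif) :
    ∫ t, envDeriv g F lam' (1 - t) * (envDeriv g F lam' (1 - t) - lam' * quantile F t) ∂unif ≤
      ∫ t, envDeriv g F lam' (1 - t) * (envDeriv g F lam (1 - t) - lam * quantile F t) ∂unif := by
  -- The test law has the reflected derivative at level `lam'` as quantile function: the bound at
  -- level `lam` holds for it, and at level `lam'` there is equality. The shape `0 + 1 * _` is the
  -- case `A = 0`, `B = 1` of `rho_eq_of_quantile`.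
  have hQ : IsQuantileOf (fun t => 0 + 1 * envDeriv g F lam' (1 - t)) _ :=
    isQuantileOf_rightDeriv (φ := fun x => 0 + 1 * x)
      (isRegular_tilt hg hF lam').concaveOn_env (fun x y h => by simpa using h) (by fun_prop)
  have h2 : MemLp (fun t => 0 + 1 * envDeriv g F lam' (1 - t)) 2 unif := by
    simpa using memLp_comp_one_sub hP'
  have := rho_le_integral hg hF hP hQ h2
  rw [rho_eq_of_quantile hg hF hP' hQ h2, EReal.coe_le_coe_iff] at this
  simpa using this

lemma integral_envDeriv (hg : IsRegular g) (hF : IsM2 F) (lam : ℝ) :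
    ∫ t, envDeriv g F lam t ∂unif = g 1 + lam * ∫ t, quantile F t ∂unif := by
  rw [envDeriv, (isRegular_tilt hg hF lam).integral_env, tilt_one]

end Tilt

/-! ### Variational inequalities in a Hilbert space -/

section Hilbert

variable {E : Type*} [NormedAddCommGroup E] [InnerProductSpace ℝ E]

/-- The sum of the two inequalities is `‖x - y‖² ≤ (l - l') ⟨x - y, f⟩`. -/
lemma norm_sub_le_of_variational {x y f : E} {l l' : ℝ}
    (h : inner ℝ y y - l' * inner ℝ y f ≤ inner ℝ y x - l * inner ℝ y f)
    (h' : inner ℝ x x - l * inner ℝ x f ≤ inner ℝ x y - l' * inner ℝ x f) :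
    ‖x - y‖ ≤ |l - l'| * ‖f‖ := by
  have h1 : ‖x - y‖ * ‖x - y‖ ≤ (l - l') * inner ℝ (x - y) f := by
    rw [← real_inner_self_eq_norm_mul_norm, inner_sub_sub_self]
    simp only [inner_sub_left]
    have : inner ℝ y x = inner ℝ x y := real_inner_comm x y
    linarith
  have h2 : (l - l') * inner ℝ (x - y) f ≤ |l - l'| * (‖x - y‖ * ‖f‖) :=
    (le_abs_self _).trans (by
      rw [abs_mul]
      exact mul_le_mul_of_nonneg_left (abs_real_inner_le_norm _ _) (abs_nonneg _))
  rcases eq_or_lt_of_le (norm_nonneg (x - y)) with h0 | h0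
  · rw [← h0]; positivity
  · refine le_of_mul_le_mul_right ?_ h0
    linarith

/-- With `y = x l / l`, the second hypothesis gives `⟨y, y - f⟩ ≤ O(1/l)`, and a lower bound for
`⟨f, y - f⟩` of the same order would finish. Such a bound is assumed only for approximations `k n`
of `f`, with constants that may depend on `n`; so `n` is fixed first, at the cost of an error `‖k n
- f‖` uniform in `l ≥ 1`. -/
lemma tendsto_inv_smul_of_variational {x : ℝ → E} {f : E} {k : ℕ → E} {C : ℕ → ℝ}
    (hlip : ∀ l, 0 ≤ l → ‖x l - x 0‖ ≤ l * ‖f‖)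
    (hle : ∀ l, 0 ≤ l → inner ℝ (x l) (x l) - l * inner ℝ (x l) f ≤ inner ℝ (x l) (x 0))
    (hk : Tendsto k atTop (𝓝 f))
    (hC : ∀ n l, 0 ≤ l → C n ≤ inner ℝ (k n) (x l) - l * inner ℝ (k n) f) :
    Tendsto (fun l => l⁻¹ • x l) atTop (𝓝 f) := by
  set R := ‖f‖ + ‖x 0‖ with hR
  have hR0 : 0 ≤ R := by positivity
  have hmain : ∀ n l, 1 ≤ l → ‖l⁻¹ • x l - f‖ ^ 2 ≤
      (R * ‖x 0‖ - C n) / l + ‖k n - f‖ * (R + ‖f‖) := by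
    intro n l hl
    have hl0 : 0 < l := by linarith
    set y := l⁻¹ • x l with hy
    have hx : x l = l • y := by rw [hy, smul_inv_smul₀ hl0.ne']
    have hyn : ‖y‖ ≤ R := by
      have h1 : ‖x l‖ ≤ l * ‖f‖ + ‖x 0‖ := by
        calc ‖x l‖ = ‖(x l - x 0) + x 0‖ := by simp
          _ ≤ _ := (norm_add_le _ _).trans (by linarith [hlip l hl0.le])
      rw [hx, norm_smul, Real.norm_of_nonneg hl0.le] at h1
      have h2 : l * ‖y‖ ≤ l * R := by
        rw [hR]; nlinarith [norm_nonneg (x 0)]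
      exact le_of_mul_le_mul_left h2 hl0
    have ha := hle l hl0.le
    have hb := hC n l hl0.le
    rw [hx] at ha hb
    simp only [inner_smul_left, inner_smul_right, RCLike.conj_to_real] at ha hb
    have ha' : inner ℝ y (y - f) ≤ R * ‖x 0‖ / l := by
      rw [le_div_iff₀ hl0, inner_sub_right]
      have h3 : inner ℝ y (x 0) ≤ R * ‖x 0‖ :=
        (real_inner_le_norm _ _).trans (mul_le_mul_of_nonneg_right hyn (norm_nonneg _))
      have h4 : l * ((inner ℝ y y - inner ℝ y f) * l) ≤ l * (R * ‖x 0‖) := by nlinarith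
      exact le_of_mul_le_mul_left h4 hl0
    have hb' : C n / l ≤ inner ℝ (k n) (y - f) := by
      rw [div_le_iff₀ hl0, inner_sub_right]; linarith
    have hc : inner ℝ (k n - f) (y - f) ≤ ‖k n - f‖ * (R + ‖f‖) :=
      (real_inner_le_norm _ _).trans (mul_le_mul_of_nonneg_left
        ((norm_sub_le _ _).trans (by linarith)) (norm_nonneg _))
    rw [← real_inner_self_eq_norm_sq]
    have : inner ℝ (y - f) (y - f) =
        inner ℝ y (y - f) - inner ℝ (k n) (y - f) + inner ℝ (k n - f) (y - f) := by
      rw [inner_sub_left (𝕜 := ℝ) y f, inner_sub_left (𝕜 := ℝ) (k n) f]; ring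
    rw [this, sub_div]
    linarith
  rw [tendsto_iff_norm_sub_tendsto_zero]
  have hsq : Tendsto (fun l => ‖l⁻¹ • x l - f‖ ^ 2) atTop (𝓝 0) := by
    refine tendsto_order.2 ⟨fun a ha => Eventually.of_forall fun l =>
      ha.trans_le (sq_nonneg _), fun a ha => ?_⟩
    have hk' : Tendsto (fun n => ‖k n - f‖ * (R + ‖f‖)) atTop (𝓝 0) := by
      simpa using (tendsto_iff_norm_sub_tendsto_zero.1 hk).mul_const (R + ‖f‖)
    obtain ⟨n, hn⟩ := (hk'.eventually (gt_mem_nhds (half_pos ha))).exists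
    have hl' : Tendsto (fun l : ℝ => (R * ‖x 0‖ - C n) / l) atTop (𝓝 0) :=
      tendsto_const_nhds.div_atTop tendsto_id
    filter_upwards [hl'.eventually (gt_mem_nhds (half_pos ha)), eventually_ge_atTop 1]
      with l h1 h2
    linarith [hmain n l h2]
  have := hsq.sqrt
  simpa using this

end Hilbert

lemma inner_toLp {X Y : ℝ → ℝ} (hX : MemLp X 2 unif) (hY : MemLp Y 2 unif) :
    inner ℝ hX.toLp hY.toLp = ∫ t, X t * Y t ∂unif := by
  rw [L2.inner_def]
  refine integral_congr_ae ?_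
  filter_upwards [hX.coeFn_toLp, hY.coeFn_toLp] with t h1 h2
  rw [h1, h2]
  simp [mul_comm]

lemma integral_mul_le_sqrt {X Y : ℝ → ℝ} (hX : MemLp X 2 unif) (hY : MemLp Y 2 unif) :
    ∫ t, X t * Y t ∂unif ≤ √(∫ t, X t ^ 2 ∂unif) * √(∫ t, Y t ^ 2 ∂unif) := by
  have h : ∀ {Z : ℝ → ℝ} (hZ : MemLp Z 2 unif), ‖hZ.toLp‖ = √(∫ t, Z t ^ 2 ∂unif) := by
    intro Z hZ
    rw [norm_eq_sqrt_real_inner, inner_toLp]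
    simp only [pow_two]
  rw [← inner_toLp hX hY, ← h hX, ← h hY]
  exact real_inner_le_norm _ _

/-- The reflected envelope derivative, a quantile function up to a positive affine map. -/
noncomputable abbrev envQuantile (g : ℝ → ℝ) (F : Measure ℝ) (lam : ℝ) : ℝ → ℝ :=
  fun t => envDeriv g F lam (1 - t)

/-- The reflected envelope derivative as a vector of `L²`. -/
noncomputable def envVec (g : ℝ → ℝ) (F : Measure ℝ) (lam : ℝ) : Lp ℝ 2 unif :=
  open Classical in
  if h : MemLp (envQuantile g F lam) 2 unif then h.toLp else 0

/-- The correlation of the reference quantile function and the reflected envelope derivative. -/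
noncomputable abbrev envCorr (g : ℝ → ℝ) (F : Measure ℝ) (lam : ℝ) : ℝ :=
  corr (quantile F) (envQuantile g F lam) unif

lemma c0_eq (g : ℝ → ℝ) (F : Measure ℝ) : c0 g F = envCorr g F 0 := by
  rw [c0, ← envDeriv_zero g F]

/-! ### Dependence of the envelope derivative on the multiplier -/

section Family

variable {g : ℝ → ℝ} {F : Measure ℝ}

lemma memLp_envQuantile (hg : IsRegular g) (hF : IsM2 F)
    (h2 : MemLp (rightDeriv (concaveEnv g)) 2 unif) {lam : ℝ} (hl : 0 ≤ lam) :
    MemLp (envQuantile g F lam) 2 unif :=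
  memLp_comp_one_sub (memLp_envDeriv hg hF h2 hl)

lemma integral_envQuantile (hg : IsRegular g) (hF : IsM2 F) (lam : ℝ) :
    ∫ t, envQuantile g F lam t ∂unif = g 1 + lam * ∫ t, quantile F t ∂unif := by
  rw [← integral_envDeriv hg hF lam]
  exact integral_comp_one_sub _

lemma envVec_eq (hg : IsRegular g) (hF : IsM2 F)
    (h2 : MemLp (rightDeriv (concaveEnv g)) 2 unif) {lam : ℝ} (hl : 0 ≤ lam) :
    envVec g F lam = (memLp_envQuantile hg hF h2 hl).toLp := by
  rw [envVec, dif_pos]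

lemma inner_envVec_variational (hg : IsRegular g) (hF : IsM2 F)
    (h2 : MemLp (rightDeriv (concaveEnv g)) 2 unif) {l l' : ℝ} (hl : 0 ≤ l) (hl' : 0 ≤ l') :
    inner ℝ (envVec g F l') (envVec g F l') -
        l' * inner ℝ (envVec g F l') hF.memLp_quantile.toLp ≤
      inner ℝ (envVec g F l') (envVec g F l) -
        l * inner ℝ (envVec g F l') hF.memLp_quantile.toLp := by
  have hP := memLp_envQuantile hg hF h2 hl
  have hP' := memLp_envQuantile hg hF h2 hl'
  have hf := hF.memLp_quantile
  have h := envDeriv_variational hg hF (memLp_envDeriv hg hF h2 hl) (memLp_envDeriv hg hF h2 hl')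
  rw [envVec_eq hg hF h2 hl, envVec_eq hg hF h2 hl', inner_toLp, inner_toLp, inner_toLp]
  have e : ∀ {Q : ℝ → ℝ} (_ : MemLp Q 2 unif) (c : ℝ),
      ∫ t, envQuantile g F l' t * (Q t - c * quantile F t) ∂unif =
      ∫ t, envQuantile g F l' t * Q t ∂unif -
        c * ∫ t, envQuantile g F l' t * quantile F t ∂unif := by
    intro Q hQ c
    rw [← integral_const_mul, ← integral_sub (integrable_mul_of_memLp hP' hQ)
      ((integrable_mul_of_memLp hP' hf).const_mul c)]
    refine integral_congr_ae (Eventually.of_forall fun t => ?_)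
    simp only; ring
  have e1 := e hP' l'
  have e2 := e hP l
  simp only [envQuantile] at e1 e2 ⊢
  linarith

lemma norm_envVec_sub_le (hg : IsRegular g) (hF : IsM2 F)
    (h2 : MemLp (rightDeriv (concaveEnv g)) 2 unif) {l l' : ℝ} (hl : 0 ≤ l) (hl' : 0 ≤ l') :
    ‖envVec g F l - envVec g F l'‖ ≤ |l - l'| * ‖(hF.memLp_quantile.toLp : Lp ℝ 2 unif)‖ :=
  norm_sub_le_of_variational (inner_envVec_variational hg hF h2 hl hl')
    (inner_envVec_variational hg hF h2 hl' hl)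

lemma continuousOn_envVec (hg : IsRegular g) (hF : IsM2 F)
    (h2 : MemLp (rightDeriv (concaveEnv g)) 2 unif) : ContinuousOn (envVec g F) (Ici 0) := by
  have : LipschitzOnWith ‖(hF.memLp_quantile.toLp : Lp ℝ 2 unif)‖₊ (envVec g F) (Ici 0) :=
    LipschitzOnWith.of_dist_le_mul fun l hl l' hl' => by
      rw [dist_eq_norm, Real.dist_eq, coe_nnnorm, mul_comm]
      exact norm_envVec_sub_le hg hF h2 hl hl'
  exact this.continuousOn

lemma variance_envQuantile (hg : IsRegular g) (hF : IsM2 F)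
    (h2 : MemLp (rightDeriv (concaveEnv g)) 2 unif) {l : ℝ} (hl : 0 ≤ l) :
    variance (envQuantile g F l) unif = inner ℝ (envVec g F l) (envVec g F l) -
      (g 1 + l * ∫ t, quantile F t ∂unif) ^ 2 := by
  rw [variance_eq_sub (memLp_envQuantile hg hF h2 hl), integral_envQuantile hg hF,
    envVec_eq hg hF h2 hl, inner_toLp]
  simp only [Pi.pow_apply, pow_two]

lemma covariance_envQuantile (hg : IsRegular g) (hF : IsM2 F)
    (h2 : MemLp (rightDeriv (concaveEnv g)) 2 unif) {l : ℝ} (hl : 0 ≤ l) :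
    covariance (quantile F) (envQuantile g F l) unif =
      inner ℝ hF.memLp_quantile.toLp (envVec g F l) -
      (∫ t, quantile F t ∂unif) * (g 1 + l * ∫ t, quantile F t ∂unif) := by
  rw [covariance_eq_sub hF.memLp_quantile (memLp_envQuantile hg hF h2 hl),
    integral_envQuantile hg hF, envVec_eq hg hF h2 hl, inner_toLp]
  rfl

lemma continuousWithinAt_envCorr (hg : IsRegular g) (hF : IsM2 F)
    (h2 : MemLp (rightDeriv (concaveEnv g)) 2 unif) {l : ℝ} (hl : 0 ≤ l)
    (hf : 0 < variance (quantile F) unif) (hv : 0 < variance (envQuantile g F l) unif) :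
    ContinuousWithinAt (envCorr g F) (Ici 0) l := by
  have hx := continuousOn_envVec hg hF h2 l hl
  have heq : ∀ r ∈ Ici (0 : ℝ), envCorr g F r =
      (inner ℝ hF.memLp_quantile.toLp (envVec g F r) -
        (∫ t, quantile F t ∂unif) * (g 1 + r * ∫ t, quantile F t ∂unif)) /
      (√(variance (quantile F) unif) * √(inner ℝ (envVec g F r) (envVec g F r) -
        (g 1 + r * ∫ t, quantile F t ∂unif) ^ 2)) := fun r hr => by
    rw [envCorr, corr, covariance_envQuantile hg hF h2 hr, variance_envQuantile hg hF h2 hr]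
  refine ContinuousWithinAt.congr ?_ heq (heq l hl)
  refine ContinuousWithinAt.div ((continuousWithinAt_const.inner hx).sub (by fun_prop))
    (continuousWithinAt_const.mul (ContinuousWithinAt.sqrt ((hx.inner hx).sub (by fun_prop)))) ?_
  rw [← variance_envQuantile hg hF h2 hl]
  exact (mul_pos (Real.sqrt_pos.2 hf) (Real.sqrt_pos.2 hv)).ne'

/-- Outside `[-N, N]` the integrands vanish, so boundedness of `g` is enough. For unbounded quantile
functions `rho` could be `⊥`, which is why the test laws are truncated. -/
lemma exists_le_rho_of_bounded (hg : IsRegular g) {q : ℝ → ℝ} {G : Measure ℝ}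
    (hq : IsQuantileOf q G) {N : ℝ} (hN : ∀ t, |q t| ≤ N) : ∃ C : ℝ, (C : EReal) ≤ rho g G := by
  obtain ⟨M, hM⟩ := hg.bounded
  have h1 : ∀ x ∈ Ioi (0 : ℝ), (Ioc 0 N).indicator (fun _ => -M) x ≤ g (1 - cdf G x) := by
    intro x hx
    by_cases hxN : x ≤ N
    · rw [indicator_of_mem (show x ∈ Ioc 0 N from ⟨hx, hxN⟩)]
      exact (abs_le.1 (hM _ (one_sub_cdf_mem G x))).1
    · rw [indicator_of_notMem fun h : x ∈ Ioc 0 N => hxN h.2]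
      have hc : cdf G x = 1 := by
        refine le_antisymm (cdf_le_one G x) (le_of_forall_lt fun c hc => ?_)
        obtain ⟨p, hp1, hp2⟩ := exists_between (max_lt hc zero_lt_one)
        exact ((le_max_left _ _).trans_lt hp1).trans_le ((hq p
          ⟨(le_max_right _ _).trans_lt hp1, hp2⟩ x).1
          ((abs_le.1 (hN p)).2.trans (not_le.1 hxN).le))
      rw [hc, sub_self, hg.map_zero]
  have h2 : ∀ x ∈ Iio (0 : ℝ),
      (Ico (-N) 0).indicator (fun _ => -M - g 1) x ≤ g (1 - cdf G x) - g 1 := by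
    intro x hx
    by_cases hxN : -N ≤ x
    · rw [indicator_of_mem (show x ∈ Ico (-N) 0 from ⟨hxN, hx⟩)]
      exact sub_le_sub_right (abs_le.1 (hM _ (one_sub_cdf_mem G x))).1 _
    · rw [indicator_of_notMem fun h : x ∈ Ico (-N) 0 => hxN h.1]
      have hc : cdf G x = 0 := by
        refine le_antisymm (le_of_forall_gt fun c hc => ?_) (cdf_nonneg G x)
        obtain ⟨p, hp1, hp2⟩ := exists_between (lt_min hc zero_lt_one)
        exact ((hq.lt_iff ⟨hp1, hp2.trans_le (min_le_right _ _)⟩ x).1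
          ((not_le.1 hxN).trans_le (abs_le.1 (hN p)).1)).trans
          (hp2.trans_le (min_le_left _ _))
      rw [hc, sub_zero, sub_self]
  have i1 : IntegrableOn ((Ioc 0 N).indicator fun _ => -M) (Ioi 0) :=
    ((integrable_indicator_iff measurableSet_Ioc).2
      (integrableOn_const (by simp))).integrableOn
  have i2 : IntegrableOn ((Ico (-N) 0).indicator fun _ => -M - g 1) (Iio 0) :=
    ((integrable_indicator_iff measurableSet_Ico).2
      (integrableOn_const (by simp))).integrableOn
  refine ⟨(∫ x in Ioi 0, (Ioc 0 N).indicator (fun _ => -M) x) +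
    ∫ x in Iio 0, (Ico (-N) 0).indicator (fun _ => -M - g 1) x, ?_⟩
  rw [EReal.coe_add, ← extIntegral_of_integrableOn i1, ← extIntegral_of_integrableOn i2]
  exact add_le_add (extIntegral_mono measurableSet_Ioi h1) (extIntegral_mono measurableSet_Iio h2)

lemma isQuantileOf_clamp_quantile (hF : IsM2 F) (N : ℝ) :
    IsQuantileOf (fun t => clamp N (quantile F t)) (unif.map fun t => clamp N (quantile F t)) := by
  have := hF.1
  have hQ := isQuantileOf_quantile F
  refine isQuantileOf_map (fun x hx y hy hxy => monotone_clamp N (hQ.monotoneOn hx hy hxy))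
    fun p hp => ((continuous_clamp N).tendsto _).comp (tendsto_order.2 ⟨fun a ha => ?_,
      fun a ha => ?_⟩)
  · have hlt := (hQ.lt_iff hp a).1 ha
    filter_upwards [Ioo_mem_nhdsLT (max_lt hlt hp.1)] with t ht
    exact (hQ.lt_iff ⟨(le_max_right _ _).trans_lt ht.1, ht.2.trans hp.2⟩ a).2
      ((le_max_left _ _).trans_lt ht.1)
  · filter_upwards [Ioo_mem_nhdsLT hp.1] with t ht
    exact (hQ.monotoneOn ⟨ht.1, ht.2.trans hp.2⟩ hp ht.2.le).trans_lt ha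

lemma tendsto_clamp_toLp (hF : IsM2 F) :
    Tendsto (fun n : ℕ => (memLp_clamp_comp hF.memLp_quantile.aemeasurable
      (n.cast_nonneg : (0 : ℝ) ≤ n)).toLp) atTop (𝓝 (hF.memLp_quantile.toLp : Lp ℝ 2 unif)) := by
  have hf := hF.memLp_quantile
  rw [tendsto_iff_norm_sub_tendsto_zero]
  have hn : ∀ n : ℕ, ‖(memLp_clamp_comp hf.aemeasurable (n.cast_nonneg : (0 : ℝ) ≤ n)).toLp -
      (hf.toLp : Lp ℝ 2 unif)‖ =
      √(∫ t, (clamp n (quantile F t) - quantile F t) ^ 2 ∂unif) := fun n => by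
    rw [← MemLp.toLp_sub, norm_eq_sqrt_real_inner, inner_toLp]
    simp only [Pi.sub_apply, pow_two]
  simp only [hn]
  rw [← Real.sqrt_zero]
  refine Tendsto.sqrt ?_
  have h0 : ∫ t, (fun _ => (0 : ℝ)) t ∂unif = 0 := by simp
  rw [← h0]
  refine tendsto_integral_of_dominated_convergence (fun t => 4 * quantile F t ^ 2)
    (fun n => ?_) (hf.integrable_sq.const_mul 4) (fun n => Eventually.of_forall fun t => ?_)
    (Eventually.of_forall fun t => ?_)
  · exact ((memLp_clamp_comp hf.aemeasurable n.cast_nonneg).sub hf).aestronglyMeasurable.pow 2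
  · have h1 := abs_clamp_le_abs (n.cast_nonneg : (0 : ℝ) ≤ n) (quantile F t)
    have h2 : |clamp n (quantile F t) - quantile F t| ≤ 2 * |quantile F t| :=
      (abs_sub _ _).trans (by linarith)
    rw [Real.norm_eq_abs, abs_of_nonneg (sq_nonneg _), ← sq_abs]
    nlinarith [abs_nonneg (clamp n (quantile F t) - quantile F t), sq_abs (quantile F t)]
  · refine tendsto_const_nhds.congr' ?_
    filter_upwards [eventually_clamp_eq (quantile F t)] with n hn
    rw [hn]; simp

lemma tendsto_inv_smul_envVec (hg : IsRegular g) (hF : IsM2 F)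
    (h2 : MemLp (rightDeriv (concaveEnv g)) 2 unif) :
    Tendsto (fun l : ℝ => l⁻¹ • envVec g F l) atTop
      (𝓝 (hF.memLp_quantile.toLp : Lp ℝ 2 unif)) := by
  have hf := hF.memLp_quantile
  have hC : ∀ n : ℕ, ∃ C : ℝ, (C : EReal) ≤ rho g (unif.map fun t => clamp n (quantile F t)) :=
    fun n => exists_le_rho_of_bounded hg (isQuantileOf_clamp_quantile hF n)
      fun t => abs_clamp_le n.cast_nonneg _
  choose C hC using hC
  refine tendsto_inv_smul_of_variational (C := C) (fun l hl => ?_) (fun l hl => ?_)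
    (tendsto_clamp_toLp hF) fun n l hl => ?_
  · simpa [abs_of_nonneg hl] using norm_envVec_sub_le hg hF h2 hl le_rfl
  · simpa using inner_envVec_variational hg hF h2 le_rfl hl
  · have hk := memLp_clamp_comp hf.aemeasurable (n.cast_nonneg : (0 : ℝ) ≤ n)
    have hP := memLp_envQuantile hg hF h2 hl
    have h := (hC n).trans (rho_le_integral hg hF (memLp_envDeriv hg hF h2 hl)
      (isQuantileOf_clamp_quantile hF n) hk)
    rw [EReal.coe_le_coe_iff] at h
    rw [envVec_eq hg hF h2 hl, inner_toLp, inner_toLp, ← integral_const_mul,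
      ← integral_sub (integrable_mul_of_memLp hk hP) ((integrable_mul_of_memLp hk hf).const_mul l)]
    refine h.trans (le_of_eq (integral_congr_ae (Eventually.of_forall fun t => ?_)))
    simp only [envQuantile]; ring

/-- Correlation is invariant under scaling by `l⁻¹`, and the rescaled vectors converge to the
quantile function of `F`, whose correlation with itself is `1`. -/
lemma tendsto_envCorr_atTop (hg : IsRegular g) (hF : IsM2 F)
    (h2 : MemLp (rightDeriv (concaveEnv g)) 2 unif)
    (hv : 0 < variance (quantile F) unif) :
    Tendsto (envCorr g F) atTop (𝓝 1) := by
  have hf := hF.memLp_quantile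
  set m := ∫ t, quantile F t ∂unif with hm
  have hy := tendsto_inv_smul_envVec hg hF h2
  have hvar : variance (quantile F) unif =
      inner ℝ (hf.toLp : Lp ℝ 2 unif) hf.toLp - m ^ 2 := by
    rw [variance_eq_sub hf, inner_toLp]
    simp only [Pi.pow_apply, pow_two, hm]
  have hlin : Tendsto (fun l : ℝ => g 1 * l⁻¹ + m) atTop (𝓝 m) := by
    simpa using (tendsto_inv_atTop_zero.const_mul (g 1)).add_const m
  have hlim : Tendsto (fun l : ℝ => (inner ℝ hf.toLp (l⁻¹ • envVec g F l) -
      m * (g 1 * l⁻¹ + m)) / (√(variance (quantile F) unif) *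
      √(inner ℝ (l⁻¹ • envVec g F l) (l⁻¹ • envVec g F l) - (g 1 * l⁻¹ + m) ^ 2))) atTop
      (𝓝 ((inner ℝ (hf.toLp : Lp ℝ 2 unif) hf.toLp - m * m) / (√(variance (quantile F) unif) *
      √(inner ℝ (hf.toLp : Lp ℝ 2 unif) hf.toLp - m ^ 2)))) := by
    refine Tendsto.div ((tendsto_const_nhds.inner hy).sub (hlin.const_mul m))
      (tendsto_const_nhds.mul (((hy.inner hy).sub (hlin.pow 2)).sqrt)) ?_
    rw [← hvar]
    exact (mul_pos (Real.sqrt_pos.2 hv) (Real.sqrt_pos.2 hv)).ne'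
  rw [← pow_two m, ← hvar, Real.mul_self_sqrt hv.le, div_self hv.ne'] at hlim
  refine hlim.congr' ?_
  filter_upwards [eventually_gt_atTop 0] with l hl
  rw [envCorr, corr, covariance_envQuantile hg hF h2 hl.le, variance_envQuantile hg hF h2 hl.le]
  simp only [inner_smul_left, inner_smul_right, RCLike.conj_to_real, ← hm]
  have e1 : l⁻¹ * (l⁻¹ * inner ℝ (envVec g F l) (envVec g F l)) - (g 1 * l⁻¹ + m) ^ 2 =
      (l⁻¹) ^ 2 * (inner ℝ (envVec g F l) (envVec g F l) - (g 1 + l * m) ^ 2) := by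
    field_simp
  have e2 : l⁻¹ * inner ℝ hf.toLp (envVec g F l) - m * (g 1 * l⁻¹ + m) =
      l⁻¹ * (inner ℝ hf.toLp (envVec g F l) - m * (g 1 + l * m)) := by
    field_simp
  rw [e1, e2, Real.sqrt_mul (sq_nonneg _), Real.sqrt_sq (inv_nonneg.2 hl.le),
    mul_left_comm, mul_div_mul_left _ _ (inv_pos.2 hl).ne']

end Family

/-! ### Moments, covariance and correlation on the unit interval -/

section Covariance

variable {X Y : ℝ → ℝ}

lemma covariance_le_sqrt (hX : MemLp X 2 unif) (hY : MemLp Y 2 unif) :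
    covariance X Y unif ≤ √(variance X unif) * √(variance Y unif) := by
  rw [variance_eq_integral hX.aemeasurable, variance_eq_integral hY.aemeasurable]
  exact integral_mul_le_sqrt (hX.sub (memLp_const _)) (hY.sub (memLp_const _))

lemma corr_le_one (hX : MemLp X 2 unif) (hY : MemLp Y 2 unif) : corr X Y unif ≤ 1 :=
  div_le_one_of_le₀ (covariance_le_sqrt hX hY) (by positivity)

lemma integral_sub_sq (hX : MemLp X 2 unif) (hY : MemLp Y 2 unif) :
    ∫ t, (X t - Y t) ^ 2 ∂unif =
      ∫ t, X t ^ 2 ∂unif - 2 * ∫ t, X t * Y t ∂unif + ∫ t, Y t ^ 2 ∂unif := by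
  have h := integrable_mul_of_memLp hX hY
  have h' : Integrable (fun t => X t ^ 2 - 2 * (X t * Y t)) unif :=
    hX.integrable_sq.sub (h.const_mul 2)
  rw [← integral_const_mul, ← integral_sub hX.integrable_sq (h.const_mul 2),
    ← integral_add h' hY.integrable_sq]
  refine integral_congr_ae (Eventually.of_forall fun t => ?_)
  simp only; ring

lemma integral_sq_eq (hX : MemLp X 2 unif) :
    ∫ t, X t ^ 2 ∂unif = variance X unif + (∫ t, X t ∂unif) ^ 2 := by
  rw [variance_eq_sub hX]
  simp only [Pi.pow_apply]; ring

lemma integral_mul_eq (hX : MemLp X 2 unif) (hY : MemLp Y 2 unif) :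
    ∫ t, X t * Y t ∂unif =
      covariance X Y unif + (∫ t, X t ∂unif) * ∫ t, Y t ∂unif := by
  rw [covariance_eq_sub hX hY]
  simp only [Pi.mul_apply]; ring

lemma variance_comp_one_sub (hX : MemLp X 2 unif) :
    variance (fun t => X (1 - t)) unif = variance X unif := by
  have h1 := integral_sq_eq (memLp_comp_one_sub hX)
  have h2 := integral_sq_eq hX
  rw [integral_comp_one_sub X, integral_comp_one_sub fun t => X t ^ 2] at h1
  linarith

lemma variance_eq_zero_of_const {c : ℝ} (h : ∀ᵐ t ∂unif, X t = c) : variance X unif = 0 := by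
  have h1 : ∫ t, X t ∂unif = c := by
    rw [integral_congr_ae (g := fun _ => c) h]; simp
  have hXm : AEMeasurable X unif := (aemeasurable_const (b := c)).congr (h.mono fun t ht => ht.symm)
  rw [variance_eq_integral hXm, h1]
  refine integral_eq_zero_of_ae (h.mono fun t ht => ?_)
  simp [ht]

/-- Zero variance gives equality with the mean almost everywhere only; such points are dense, and
antitonicity squeezes the remaining values. -/
lemma variance_pos_of_antitoneOn (hX : MemLp X 2 unif) (ha : AntitoneOn X (Ioo 0 1))
    (hc : ¬ IsConstant X) : 0 < variance X unif := by
  refine lt_of_le_of_ne (variance_nonneg X unif) fun h0 => hc ⟨∫ t, X t ∂unif, fun t ht => ?_⟩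
  rw [variance_eq_integral hX.aemeasurable] at h0
  have hz := (integral_eq_zero_iff_of_nonneg (fun t => sq_nonneg _)
    (hX.sub (memLp_const _)).integrable_sq).1 h0.symm
  have hae : ∀ᵐ t ∂(volume : Measure ℝ), t ∈ Ioo (0 : ℝ) 1 → X t = ∫ t, X t ∂unif := by
    refine (ae_restrict_iff' measurableSet_Ioo).1 ?_
    filter_upwards [hz] with t ht
    exact sub_eq_zero.1 (pow_eq_zero_iff two_ne_zero |>.1 ht)
  have hd := Measure.dense_of_ae hae
  obtain ⟨r, hr, hr0, hrt⟩ := hd.exists_between ht.1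
  obtain ⟨s, hs, hts, hs1⟩ := hd.exists_between ht.2
  have hr' : r ∈ Ioo (0 : ℝ) 1 := ⟨hr0, hrt.trans ht.2⟩
  have hs' : s ∈ Ioo (0 : ℝ) 1 := ⟨ht.1.trans hts, hs1⟩
  refine le_antisymm ?_ ?_
  · rw [← hr hr']; exact ha hr' ht hrt.le
  · rw [← hs hs']; exact ha ht hs' hts.le

end Covariance

/-! ### Small multipliers when the envelope is linear -/

section LinearEnvelope

variable {g : ℝ → ℝ} {F : Measure ℝ}

lemma IsRegular.env_eq_linear (hg : IsRegular g) (hc : IsConstant (rightDeriv (concaveEnv g)))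
    {t : ℝ} (ht : t ∈ Icc (0 : ℝ) 1) : concaveEnv g t = g 1 * t := by
  obtain ⟨c, hc⟩ := hc
  have key : ∀ t ∈ Icc (0 : ℝ) 1, concaveEnv g t = c * t := by
    intro t ht
    rw [hg.env_eq_integral ht, intervalIntegral.integral_of_le ht.1, integral_Ioc_eq_integral_Ioo,
      setIntegral_congr_fun (g := fun _ => c) measurableSet_Ioo
        (fun s hs => hc s ⟨hs.1, hs.2.trans_le ht.2⟩)]
    simp [ht.1, mul_comm]
  have h1 := key 1 (by simp)
  rw [hg.env_one, mul_one] at h1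
  rw [key t ht, h1]

/-- Comparison of the tilted envelope with an absolutely continuous majorant whose density is a
perturbation of a constant. -/
lemma integral_envQuantile_mul_le (hg : IsRegular g) (hF : IsM2 F)
    (h2 : MemLp (rightDeriv (concaveEnv g)) 2 unif) {l : ℝ} (hl : 0 ≤ l) {Z : ℝ → ℝ}
    (hZ : MemLp Z 2 unif) (hZ0 : ∫ t, Z t ∂unif = 0)
    (hgZ : ∀ t ∈ Icc (0 : ℝ) 1, g t ≤ g 1 * t - ∫ s in (0 : ℝ)..t, Z (1 - s)) :
    ∫ t, envQuantile g F l t * Z t ∂unif ≤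
      l * covariance (quantile F) (envQuantile g F l) unif -
        variance (envQuantile g F l) unif := by
  have hP := memLp_envQuantile hg hF h2 hl
  have hPd := memLp_envDeriv hg hF h2 hl
  have hf := hF.memLp_quantile
  have hZr := memLp_comp_one_sub hZ
  have hQ : IsQuantileOf (fun t => 0 + 1 * envDeriv g F l (1 - t))
      (unif.map fun t => 0 + 1 * envDeriv g F l (1 - t)) :=
    isQuantileOf_rightDeriv (φ := fun x => 0 + 1 * x)
      (isRegular_tilt hg hF l).concaveOn_env (fun x y h => by simpa using h) (by fun_prop)
  have hQ2 : MemLp (fun t => 0 + 1 * envDeriv g F l (1 - t)) 2 unif := by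
    simpa using hP
  have hw : MemLp (fun s => g 1 - Z (1 - s)) 2 unif := (memLp_const _).sub hZr
  have hv : ∀ t ∈ Icc (0 : ℝ) 1, g 1 * t - ∫ s in (0 : ℝ)..t, Z (1 - s) =
      ∫ s in (0 : ℝ)..t, (g 1 - Z (1 - s)) := by
    intro t ht
    rw [intervalIntegral.integral_sub (by simp)
      (intervalIntegrable_of_unif (integrable_of_memLp hZr) (by simp) ht)]
    simp [mul_comm]
  have h1 : g 1 = g 1 * 1 - ∫ s in (0 : ℝ)..1, Z (1 - s) := by
    have : ∫ s in (0 : ℝ)..1, Z (1 - s) = ∫ t, Z (1 - t) ∂unif := by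
      rw [intervalIntegral.integral_of_le zero_le_one, integral_Ioc_eq_integral_Ioo, unif]
    rw [this, integral_comp_one_sub, hZ0]; ring
  -- The test law has quantile function `envQuantile g F l`; the left side is exact because there is
  -- no duality gap.
  have hle := rho_mono hgZ h1 (unif.map fun t => 0 + 1 * envDeriv g F l (1 - t))
  rw [rho_eq_of_quantile hg hF hPd hQ hQ2, rho_eq_integral hQ (integrable_of_memLp hw)
    (integrable_mul_of_memLp hQ2 (memLp_comp_one_sub hw)) hv, EReal.coe_le_coe_iff] at hle
  have e1 : ∫ t, (0 + 1 * envDeriv g F l (1 - t)) *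
      (envDeriv g F l (1 - t) - l * quantile F t) ∂unif =
      ∫ t, envQuantile g F l t ^ 2 ∂unif - l * ∫ t, quantile F t * envQuantile g F l t ∂unif := by
    rw [← integral_const_mul, ← integral_sub hP.integrable_sq
      ((integrable_mul_of_memLp hf hP).const_mul l)]
    refine integral_congr_ae (Eventually.of_forall fun t => ?_)
    simp only; ring
  have e2 : ∫ t, (0 + 1 * envDeriv g F l (1 - t)) * (g 1 - Z (1 - (1 - t))) ∂unif =
      g 1 * ∫ t, envQuantile g F l t ∂unif - ∫ t, envQuantile g F l t * Z t ∂unif := by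
    rw [← integral_const_mul, ← integral_sub ((integrable_of_memLp hP).const_mul (g 1))
      (integrable_mul_of_memLp hP hZ)]
    refine integral_congr_ae (Eventually.of_forall fun t => ?_)
    simp only [sub_sub_cancel]; ring
  -- As the mean of `envQuantile` is `g 1 + l * ∫ f`, all products of means cancel.
  rw [e1, e2, integral_sq_eq hP, integral_mul_eq hf hP, integral_envQuantile hg hF] at hle
  linarith

/-- The unperturbed case `Z = 0`. It makes the correlation nonnegative for `l > 0`. -/
lemma variance_envQuantile_le (hg : IsRegular g) (hF : IsM2 F)
    (h2 : MemLp (rightDeriv (concaveEnv g)) 2 unif)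
    (hc : IsConstant (rightDeriv (concaveEnv g))) {l : ℝ} (hl : 0 ≤ l) :
    variance (envQuantile g F l) unif ≤
      l * covariance (quantile F) (envQuantile g F l) unif := by
  have := integral_envQuantile_mul_le hg hF h2 hl (Z := fun _ => 0) (memLp_const 0) (by simp)
    fun t ht => by simpa using (hg.le_env ht).trans_eq (hg.env_eq_linear hc ht)
  simpa using this

/-- A compactly supported perturbation with mean zero, if scaled down, stays below the gap between
a distortion function and its linear envelope. -/
lemma exists_scaled_bump (hg : IsRegular g) (hlt : ∀ t ∈ Ioo (0 : ℝ) 1, g t < g 1 * t)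
    {Z : ℝ → ℝ} (hZ : MemLp Z 2 unif) (hZ0 : ∫ t, Z t ∂unif = 0) {δ : ℝ} (hδ : 0 < δ)
    (hδ' : δ < 1 / 2) (hsupp : ∀ t ∉ Ioo δ (1 - δ), Z t = 0) :
    ∃ η > 0, ∀ t ∈ Icc (0 : ℝ) 1, g t ≤ g 1 * t - ∫ s in (0 : ℝ)..t, η * Z (1 - s) := by
  have hZr := integrable_of_memLp (memLp_comp_one_sub hZ)
  have hk := hg.add_continuous (k := fun t => -(g 1 * t)) (by fun_prop) (by simp)
  -- Semicontinuity on a compact interval turns the pointwise gap below the line into a uniform one.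
  have husc : UpperSemicontinuousOn (fun t => g t + -(g 1 * t)) (Icc δ (1 - δ)) :=
    fun t ht y hy => nhdsWithin_le_nhds
      (hk.usc t ⟨hδ.trans_le ht.1, ht.2.trans_lt (by linarith)⟩ y hy)
  obtain ⟨t₀, ht₀, hmax⟩ := husc.exists_isMaxOn
    (nonempty_Icc.2 (by linarith : δ ≤ 1 - δ)) isCompact_Icc
  obtain ⟨K, hK⟩ := isCompact_Icc.exists_bound_of_continuousOn (continuousOn_primitive hZr)
  have hgap : 0 < g 1 * t₀ - g t₀ := sub_pos.2
    (hlt t₀ ⟨hδ.trans_le ht₀.1, ht₀.2.trans_lt (by linarith)⟩)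
  have hK0 : 0 ≤ K := (norm_nonneg _).trans (hK 0 (by simp))
  -- The smallest gap divided by a bound for the primitive of the reflected `Z`; the `+ 1` keeps the
  -- denominator positive.
  set η := (g 1 * t₀ - g t₀) / (K + 1) with hη
  have hηpos : 0 < η := by positivity
  have hηK : η * (K + 1) = g 1 * t₀ - g t₀ := by rw [hη]; field_simp
  have hgle : ∀ t ∈ Icc (0 : ℝ) 1, g t ≤ g 1 * t := by
    intro t ht
    rcases eq_or_lt_of_le ht.1 with rfl | h0
    · simp [hg.map_zero]
    rcases eq_or_lt_of_le ht.2 with rfl | h1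
    · simp
    · exact (hlt t ⟨h0, h1⟩).le
  refine ⟨η, hηpos, fun t ht => ?_⟩
  rw [intervalIntegral.integral_const_mul]
  -- Near both ends the primitive vanishes, on the right because `Z` has mean zero; the uniform gap
  -- is needed only in between.
  rcases le_or_gt t δ with h | h
  · have : ∫ s in (0 : ℝ)..t, Z (1 - s) = 0 := by
      rw [intervalIntegral.integral_of_le ht.1]
      exact setIntegral_eq_zero_of_forall_eq_zero fun s hs =>
        hsupp _ fun h' => by linarith [h'.2, hs.2]
    rw [this]; linarith [hgle t ht]
  rcases le_or_gt (1 - δ) t with h' | h'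
  · have e0 : ∫ s in (0 : ℝ)..1, Z (1 - s) = 0 := by
      have : ∫ s in (0 : ℝ)..1, Z (1 - s) = ∫ t, Z (1 - t) ∂unif := by
        rw [intervalIntegral.integral_of_le zero_le_one, integral_Ioc_eq_integral_Ioo, unif]
      rw [this, integral_comp_one_sub, hZ0]
    have e1 : ∫ s in t..1, Z (1 - s) = 0 := by
      rw [intervalIntegral.integral_of_le ht.2]
      exact setIntegral_eq_zero_of_forall_eq_zero fun s hs =>
        hsupp _ fun h'' => by linarith [h''.1, hs.1]
    have e2 := intervalIntegral.integral_add_adjacent_intervals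
      (intervalIntegrable_of_unif hZr (by simp : (0 : ℝ) ∈ Icc (0 : ℝ) 1) ht)
      (intervalIntegrable_of_unif hZr ht (by simp : (1 : ℝ) ∈ Icc (0 : ℝ) 1))
    rw [e0, e1, add_zero] at e2
    rw [e2]; linarith [hgle t ht]
  · have hm : g t + -(g 1 * t) ≤ g t₀ + -(g 1 * t₀) := hmax (show t ∈ Icc δ (1 - δ) from ⟨h.le, h'.le⟩)
    have hb := (abs_le.1 (hK t ht)).2
    nlinarith

/-- Cut the quantile function off outside `(δ, 1 - δ)` and centre it by its mean over that interval,
so that the integral is exactly zero; dominated convergence as `δ → 0`. -/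
lemma exists_bump_approx (hF : IsM2 F) {κ : ℝ} (hκ : 0 < κ) :
    ∃ δ m : ℝ, ∃ Z : ℝ → ℝ, 0 < δ ∧ δ < 1 / 2 ∧ MemLp Z 2 unif ∧ ∫ t, Z t ∂unif = 0 ∧
      (∀ t ∉ Ioo δ (1 - δ), Z t = 0) ∧
      √(∫ t, (quantile F t - m - Z t) ^ 2 ∂unif) < κ := by
  have hf := hF.memLp_quantile
  have hfi := integrable_of_memLp hf
  set J : ℝ := ∫ t, |quantile F t| ∂unif with hJ
  have hJ0 : 0 ≤ J := integral_nonneg fun t => abs_nonneg _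
  set δ : ℕ → ℝ := fun n => 1 / (n + 3) with hδ
  have hδpos : ∀ n, 0 < δ n := fun n => by positivity
  have hδle : ∀ n, δ n ≤ 1 / 3 := fun n => by
    have : (0 : ℝ) ≤ n := n.cast_nonneg
    exact one_div_le_one_div_of_le (by norm_num) (by linarith)
  have hδ0 : Tendsto δ atTop (𝓝 0) := by
    refine tendsto_const_nhds.div_atTop ?_
    exact tendsto_atTop_add_const_right _ _ tendsto_natCast_atTop_atTop
  set I : ℕ → Set ℝ := fun n => Ioo (δ n) (1 - δ n) with hI
  set m : ℕ → ℝ := fun n => (∫ t in I n, quantile F t ∂unif) / (1 - 2 * δ n) with hm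
  have hIsub : ∀ n, I n ⊆ Ioo 0 1 := fun n => Ioo_subset_Ioo (hδpos n).le (by linarith [hδpos n])
  have hImeas : ∀ n, unif.real (I n) = 1 - 2 * δ n := fun n => by
    rw [Measure.real, unif, Measure.restrict_apply measurableSet_Ioo,
      inter_eq_left.2 (hIsub n), Real.volume_Ioo, ENNReal.toReal_ofReal (by linarith [hδle n])]
    ring
  -- Since `δ n ≤ 1/3`, the interval has length at least `1/3`.
  have hmb : ∀ n, |m n| ≤ 3 * J := fun n => by
    have hpos : 0 < 1 - 2 * δ n := by linarith [hδle n]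
    rw [hm, abs_div, abs_of_pos hpos, div_le_iff₀ hpos]
    have h1 : |∫ t in I n, quantile F t ∂unif| ≤ J :=
      (abs_integral_le_integral_abs).trans
        (setIntegral_le_integral hfi.abs (Eventually.of_forall fun t => abs_nonneg _))
    nlinarith [hδle n]
  set Z : ℕ → ℝ → ℝ := fun n => (I n).indicator fun t => quantile F t - m n with hZ
  have hZ2 : ∀ n, MemLp (Z n) 2 unif := fun n =>
    (hf.sub (memLp_const _)).indicator measurableSet_Ioo
  have hZ0 : ∀ n, ∫ t, Z n t ∂unif = 0 := fun n => by
    have hpos : 0 < 1 - 2 * δ n := by linarith [hδle n]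
    have hIm : MeasurableSet (I n) := measurableSet_Ioo
    have hmn : (1 - 2 * δ n) * m n = ∫ t in I n, quantile F t ∂unif :=
      mul_div_cancel₀ _ hpos.ne'
    simp only [hZ]
    rw [integral_indicator hIm, integral_sub hfi.integrableOn (by simp),
      setIntegral_const, hImeas, smul_eq_mul, hmn, sub_self]
  have hlim : Tendsto (fun n => ∫ t, (quantile F t - m n - Z n t) ^ 2 ∂unif) atTop (𝓝 0) := by
    have h0 : ∫ t, (fun _ => (0 : ℝ)) t ∂unif = 0 := by simp
    rw [← h0]
    refine tendsto_integral_of_dominated_convergence (fun t => (|quantile F t| + 3 * J) ^ 2)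
      (fun n => ?_) ?_ (fun n => Eventually.of_forall fun t => ?_) ?_
    · exact (((hf.sub (memLp_const _)).sub (hZ2 n)).aestronglyMeasurable).pow 2
    · exact (MemLp.add hf.abs (memLp_const _)).integrable_sq
    · rw [Real.norm_eq_abs, abs_of_nonneg (sq_nonneg _)]
      by_cases ht : t ∈ I n
      · simp only [hZ, indicator_of_mem ht, sub_self]
        rw [zero_pow two_ne_zero]
        positivity
      · simp only [hZ, indicator_of_notMem ht, sub_zero]
        rw [← sq_abs]
        exact pow_le_pow_left₀ (abs_nonneg _)
          ((abs_sub _ _).trans (add_le_add le_rfl (hmb n))) 2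
    · filter_upwards [ae_unif_mem] with t ht
      refine tendsto_const_nhds.congr' ?_
      filter_upwards [hδ0.eventually (gt_mem_nhds (lt_min ht.1 (sub_pos.2 ht.2)))] with n hn
      have ht' : t ∈ I n :=
        ⟨hn.trans_le (min_le_left _ _), by linarith [hn.trans_le (min_le_right t (1 - t))]⟩
      simp only [hZ, indicator_of_mem ht', sub_self]
      norm_num
  have hlim' := hlim.sqrt
  rw [Real.sqrt_zero] at hlim'
  obtain ⟨n, hn⟩ := (hlim'.eventually (gt_mem_nhds hκ)).exists
  exact ⟨δ n, m n, Z n, hδpos n, by linarith [hδle n], hZ2 n, hZ0 n,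
    fun t ht => indicator_of_notMem ht _, hn⟩

/-- At `l = 0` the variance vanishes, so continuity of the correlation is not available. Split the
covariance along `Z`, an approximation of the centred quantile function: the part along `Z` is small
because `η * Z` fits into the gap below the line, and the rest is small by Cauchy–Schwarz. -/
lemma exists_envCorr_lt_of_linear (hg : IsRegular g) (hF : IsM2 F)
    (h2 : MemLp (rightDeriv (concaveEnv g)) 2 unif)
    (hlt : ∀ t ∈ Ioo (0 : ℝ) 1, g t < g 1 * t) (hf0 : 0 < variance (quantile F) unif)
    (hv : ∀ l, 0 < l → 0 < variance (envQuantile g F l) unif) {κ : ℝ} (hκ : 0 < κ) :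
    ∃ l, 0 < l ∧ envCorr g F l < κ := by
  have hf := hF.memLp_quantile
  set sF := √(variance (quantile F) unif) with hsF
  have hsF0 : 0 < sF := Real.sqrt_pos.2 hf0
  obtain ⟨δ, m, Z, hδ, hδ', hZ, hZ0, hsupp, hsmall⟩ :=
    exists_bump_approx hF (by positivity : 0 < κ / 2 * sF)
  obtain ⟨η, hη, hgη⟩ := exists_scaled_bump hg hlt hZ hZ0 hδ hδ' hsupp
  -- The gap inequality gives `η ∫ P Z ≤ l * sF * s`; this `l` turns it into half of the allowed
  -- covariance `κ * sF * s`. The approximation error takes the other half.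
  refine ⟨η * (κ / 2), by positivity, ?_⟩
  set l := η * (κ / 2) with hl
  have hl0 : 0 < l := by positivity
  have hP := memLp_envQuantile hg hF h2 hl0.le
  set s := √(variance (envQuantile g F l) unif) with hs
  have hs0 : 0 < s := Real.sqrt_pos.2 (hv l hl0)
  set c := covariance (quantile F) (envQuantile g F l) unif with hc
  set a := ∫ t, envQuantile g F l t ∂unif with ha
  have hcle : c ≤ sF * s := covariance_le_sqrt hf hP
  have h1 : η * ∫ t, envQuantile g F l t * Z t ∂unif ≤ l * c := by
    have := integral_envQuantile_mul_le hg hF h2 hl0.le (hZ.const_mul η)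
      (by rw [integral_const_mul, hZ0, mul_zero]) hgη
    have e : ∫ t, envQuantile g F l t * (η * Z t) ∂unif =
        η * ∫ t, envQuantile g F l t * Z t ∂unif := by
      rw [← integral_const_mul]
      refine integral_congr_ae (Eventually.of_forall fun t => ?_)
      simp only; ring
    rw [e] at this
    linarith [hv l hl0]
  have h1' : ∫ t, envQuantile g F l t * Z t ∂unif ≤ κ / 2 * (sF * s) := by
    have : l * c ≤ l * (sF * s) := mul_le_mul_of_nonneg_left hcle hl0.le
    refine le_of_mul_le_mul_left ?_ hη
    calc _ ≤ _ := h1.trans this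
      _ = _ := by rw [hl]; ring
  have hY : MemLp (fun t => quantile F t - m - Z t) 2 unif := (hf.sub (memLp_const m)).sub hZ
  have hPa : MemLp (fun t => envQuantile g F l t - a) 2 unif := hP.sub (memLp_const a)
  have h3 := integral_mul_le_sqrt hPa hY
  have hvar : ∫ t, (envQuantile g F l t - a) ^ 2 ∂unif = variance (envQuantile g F l) unif :=
    (variance_eq_integral hP.aemeasurable).symm
  rw [hvar, ← hs] at h3
  have h4 : ∫ t, (envQuantile g F l t - a) * (quantile F t - m - Z t) ∂unif =
      c - ∫ t, envQuantile g F l t * Z t ∂unif := by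
    have e : ∀ t, (envQuantile g F l t - a) * (quantile F t - m - Z t) =
        (quantile F t * envQuantile g F l t - envQuantile g F l t * Z t) -
        (m * envQuantile g F l t + a * (quantile F t - m - Z t)) := fun t => by ring
    have i1 := integrable_mul_of_memLp hf hP
    have i2 := integrable_mul_of_memLp hP hZ
    have i3 := (integrable_of_memLp hP).const_mul m
    have i4 := (integrable_of_memLp hY).const_mul a
    have e5 : ∫ t, (quantile F t - m - Z t) ∂unif = (∫ t, quantile F t ∂unif) - m := by
      have hfm : Integrable (fun t => quantile F t - m) unif :=
        (integrable_of_memLp hf).sub (integrable_const m)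
      rw [integral_sub hfm (integrable_of_memLp hZ), integral_sub (integrable_of_memLp hf) (integrable_const m), hZ0]
      simp
    have i12 : Integrable (fun t => quantile F t * envQuantile g F l t -
      envQuantile g F l t * Z t) unif := i1.sub i2
    have i34 : Integrable (fun t => m * envQuantile g F l t +
      a * (quantile F t - m - Z t)) unif := i3.add i4
    simp only [e]
    rw [integral_sub i12 i34, integral_sub i1 i2, integral_add i3 i4,
      integral_const_mul, integral_const_mul, e5, integral_mul_eq hf hP]
    ring
  have h5 : s * √(∫ t, (quantile F t - m - Z t) ^ 2 ∂unif) < s * (κ / 2 * sF) :=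
    mul_lt_mul_of_pos_left hsmall hs0
  rw [envCorr, corr, div_lt_iff₀ (mul_pos hsF0 hs0)]
  calc c = (c - ∫ t, envQuantile g F l t * Z t ∂unif) +
        ∫ t, envQuantile g F l t * Z t ∂unif := by ring
    _ < s * (κ / 2 * sF) + κ / 2 * (sF * s) := by rw [← h4]; linarith
    _ = κ * (sF * s) := by ring

end LinearEnvelope

/-! ### Moments and Wasserstein distance through quantile functions -/

section Wasserstein

variable {F G : Measure ℝ} {q : ℝ → ℝ}

lemma IsM2.mean_eq (hF : IsM2 F) : mean F = ∫ t, quantile F t ∂unif := by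
  have := hF.1
  exact (isQuantileOf_quantile F).integral_comp continuous_id

lemma IsM2.stdDev_eq (hF : IsM2 F) : stdDev F = √(variance (quantile F) unif) := by
  have := hF.1
  have hQ := isQuantileOf_quantile F
  rw [stdDev, variance_eq_sub hF.2, variance_eq_sub hF.memLp_quantile]
  have h1 : ∫ x, x ∂F = ∫ t, quantile F t ∂unif := hQ.integral_comp continuous_id
  have h2 : ∫ x, x ^ 2 ∂F = ∫ t, quantile F t ^ 2 ∂unif := hQ.integral_comp (continuous_pow 2)
  simp only [Pi.pow_apply, h1, h2]

lemma dW_eq_of_quantile (hq : IsQuantileOf q G) :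
    dW F G = √(∫ t, (quantile F t - q t) ^ 2 ∂unif) := by
  rw [dW, unif]
  congr 1
  refine setIntegral_congr_fun measurableSet_Ioo fun t ht => ?_
  simp only [sq_abs, hq.quantile_eq ht]

lemma dW_comm (F G : Measure ℝ) : dW F G = dW G F := by
  simp only [dW, abs_sub_comm]

end Wasserstein

/-! ### The candidate law and its optimality -/

section Worst

variable {g : ℝ → ℝ} {F : Measure ℝ} {μ σ l : ℝ}

lemma worstQuantile_eq (h : MemLp (envDeriv g F l) 2 unif) (μ σ t : ℝ) :
    worstQuantile g F μ σ l t =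
      (μ - σ / √(variance (envQuantile g F l) unif) * ∫ t, envQuantile g F l t ∂unif) +
        σ / √(variance (envQuantile g F l) unif) * envQuantile g F l t := by
  rw [worstQuantile, ← variance_comp_one_sub h, ← integral_comp_one_sub (envDeriv g F l)]
  simp only [envQuantile]
  ring

lemma isQuantileOf_worst (hg : IsRegular g) (hF : IsM2 F)
    (h : MemLp (envDeriv g F l) 2 unif) (hσ : 0 ≤ σ) :
    IsQuantileOf (worstQuantile g F μ σ l) (worstDist g F μ σ l) := by
  have hb : 0 ≤ σ / √(variance (envQuantile g F l) unif) := by positivity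
  have hQ := isQuantileOf_rightDeriv (φ := fun x =>
      (μ - σ / √(variance (envQuantile g F l) unif) * ∫ t, envQuantile g F l t ∂unif) +
        σ / √(variance (envQuantile g F l) unif) * x)
    (isRegular_tilt hg hF l).concaveOn_env
    (fun x y hxy => add_le_add_right (mul_le_mul_of_nonneg_left hxy hb) _) (by fun_prop)
  have e := funext (worstQuantile_eq h μ σ)
  rw [worstDist, e]
  exact hQ

lemma memLp_worstQuantile (h : MemLp (envDeriv g F l) 2 unif) :
    MemLp (worstQuantile g F μ σ l) 2 unif := by
  rw [funext (worstQuantile_eq h μ σ)]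
  have hP : MemLp (envQuantile g F l) 2 unif := memLp_comp_one_sub h
  exact MemLp.add (memLp_const _) (hP.const_mul _)

/-- Integrals against the standardized envelope derivative. -/
lemma integral_mul_worstQuantile (h : MemLp (envDeriv g F l) 2 unif) {X : ℝ → ℝ}
    (hX : MemLp X 2 unif) : ∫ t, X t * worstQuantile g F μ σ l t ∂unif =
      μ * ∫ t, X t ∂unif + σ / √(variance (envQuantile g F l) unif) *
        covariance X (envQuantile g F l) unif := by
  have hP : MemLp (envQuantile g F l) 2 unif := memLp_comp_one_sub h
  set B := σ / √(variance (envQuantile g F l) unif) with hB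
  set a := ∫ t, envQuantile g F l t ∂unif with ha
  have e : ∀ t, X t * worstQuantile g F μ σ l t =
      (μ - B * a) * X t + B * (X t * envQuantile g F l t) := fun t => by
    rw [worstQuantile_eq h]; ring
  simp only [e]
  rw [integral_add ((integrable_of_memLp hX).const_mul _)
    ((integrable_mul_of_memLp hX hP).const_mul _), integral_const_mul, integral_const_mul,
    integral_mul_eq hX hP]
  ring

lemma integral_worstQuantile (h : MemLp (envDeriv g F l) 2 unif) :
    ∫ t, worstQuantile g F μ σ l t ∂unif = μ := by
  have := integral_mul_worstQuantile (μ := μ) (σ := σ) h (X := fun _ => 1) (memLp_const 1)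
  rw [covariance_const_left] at this
  simpa using this

lemma integral_envQuantile_mul_worstQuantile (h : MemLp (envDeriv g F l) 2 unif)
    (hv : 0 < variance (envQuantile g F l) unif) :
    ∫ t, envQuantile g F l t * worstQuantile g F μ σ l t ∂unif =
      μ * ∫ t, envQuantile g F l t ∂unif + σ * √(variance (envQuantile g F l) unif) := by
  have hP : MemLp (envQuantile g F l) 2 unif := memLp_comp_one_sub h
  rw [integral_mul_worstQuantile h hP, covariance_self hP.aemeasurable]
  congr 1
  have := Real.sq_sqrt hv.le
  have h0 := Real.sqrt_pos.2 hv
  field_simp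
  rw [this]

lemma integral_sq_worstQuantile (h : MemLp (envDeriv g F l) 2 unif)
    (hv : 0 < variance (envQuantile g F l) unif) :
    ∫ t, worstQuantile g F μ σ l t ^ 2 ∂unif = μ ^ 2 + σ ^ 2 := by
  have hP : MemLp (envQuantile g F l) 2 unif := memLp_comp_one_sub h
  have hW := memLp_worstQuantile (μ := μ) (σ := σ) h
  have h1 := integral_mul_worstQuantile (μ := μ) (σ := σ) h hW
  have h2 := integral_envQuantile_mul_worstQuantile (μ := μ) (σ := σ) h hv
  have h3 := integral_mul_eq hW hP
  rw [integral_worstQuantile h] at h1 h3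
  have h4 : ∫ t, worstQuantile g F μ σ l t * envQuantile g F l t ∂unif =
      ∫ t, envQuantile g F l t * worstQuantile g F μ σ l t ∂unif := by
    simp only [mul_comm]
  have h5 : covariance (worstQuantile g F μ σ l) (envQuantile g F l) unif =
      σ * √(variance (envQuantile g F l) unif) := by linarith
  have h0 := Real.sqrt_pos.2 hv
  simp only [pow_two]
  rw [h1, h5]
  field_simp

lemma integral_quantile_mul_worstQuantile (hF : IsM2 F) (h : MemLp (envDeriv g F l) 2 unif)
    (hσF : 0 < stdDev F) :
    ∫ t, quantile F t * worstQuantile g F μ σ l t ∂unif =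
      mean F * μ + stdDev F * σ * envCorr g F l := by
  rw [integral_mul_worstQuantile h hF.memLp_quantile, envCorr, corr, hF.mean_eq, ← hF.stdDev_eq]
  have := hσF.ne'
  field_simp

lemma isM2_worstDist (hg : IsRegular g) (hF : IsM2 F)
    (h : MemLp (envDeriv g F l) 2 unif) (hσ : 0 ≤ σ) : IsM2 (worstDist g F μ σ l) := by
  have hQ := isQuantileOf_worst (μ := μ) hg hF h hσ
  have : IsProbabilityMeasure (worstDist g F μ σ l) :=
    Measure.isProbabilityMeasure_map hQ.aemeasurable
  exact ⟨this, hQ.memLp_iff.2 (memLp_worstQuantile h)⟩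

lemma IsM2.integral_sq_quantile (hF : IsM2 F) :
    ∫ t, quantile F t ^ 2 ∂unif = mean F ^ 2 + stdDev F ^ 2 := by
  rw [integral_sq_eq hF.memLp_quantile, hF.mean_eq, hF.stdDev_eq,
    Real.sq_sqrt (variance_nonneg _ _)]
  ring

/-- Both laws have prescribed first and second moments, so only the cross term, that is the
correlation, depends on `l`. -/
lemma dW_worstDist (hg : IsRegular g) (hF : IsM2 F) (h : MemLp (envDeriv g F l) 2 unif)
    (hv : 0 < variance (envQuantile g F l) unif) (hσF : 0 < stdDev F) (hσ : 0 ≤ σ) :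
    dW F (worstDist g F μ σ l) = √((mean F - μ) ^ 2 + (stdDev F - σ) ^ 2 +
      2 * stdDev F * σ * (1 - envCorr g F l)) := by
  rw [dW_eq_of_quantile (isQuantileOf_worst hg hF h hσ),
    integral_sub_sq hF.memLp_quantile (memLp_worstQuantile h),
    integral_quantile_mul_worstQuantile hF h hσF, integral_sq_worstQuantile h hv,
    hF.integral_sq_quantile]
  congr 1
  ring

lemma worstDist_mem (hg : IsRegular g) (hF : IsM2 F) (h : MemLp (envDeriv g F l) 2 unif)
    (hv : 0 < variance (envQuantile g F l) unif) (hσ : 0 ≤ σ) {ε : ℝ}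
    (hd : dW F (worstDist g F μ σ l) ≤ √ε) :
    worstDist g F μ σ l ∈ uncertaintySet F μ σ ε := by
  have hM := isM2_worstDist (μ := μ) hg hF h hσ
  have := hM.1
  have hQ := isQuantileOf_worst (μ := μ) hg hF h hσ
  refine ⟨hM, ?_, ?_, by rwa [dW_comm]⟩
  · exact (hQ.integral_comp continuous_id).trans (integral_worstQuantile h)
  · rw [hQ.integral_comp (continuous_pow 2)]
    exact integral_sq_worstQuantile h hv

lemma integral_mul_tilted (hF : IsM2 F) (h : MemLp (envDeriv g F l) 2 unif) {X : ℝ → ℝ}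
    (hX : MemLp X 2 unif) :
    ∫ t, X t * (envDeriv g F l (1 - t) - l * quantile F t) ∂unif =
      ∫ t, X t * envQuantile g F l t ∂unif - l * ∫ t, quantile F t * X t ∂unif := by
  have hP : MemLp (envQuantile g F l) 2 unif := memLp_comp_one_sub h
  rw [← integral_const_mul, ← integral_sub (integrable_mul_of_memLp hX hP)
    ((integrable_mul_of_memLp hF.memLp_quantile hX).const_mul l)]
  refine integral_congr_ae (Eventually.of_forall fun t => ?_)
  simp only [envQuantile]; ring

lemma rho_worstDist (hg : IsRegular g) (hF : IsM2 F) (h : MemLp (envDeriv g F l) 2 unif)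
    (hv : 0 < variance (envQuantile g F l) unif) (hσ : 0 ≤ σ) :
    rho g (worstDist g F μ σ l) =
      ((μ * ∫ t, envQuantile g F l t ∂unif + σ * √(variance (envQuantile g F l) unif) -
        l * ∫ t, quantile F t * worstQuantile g F μ σ l t ∂unif : ℝ) : EReal) := by
  have hW := memLp_worstQuantile (μ := μ) (σ := σ) h
  rw [← integral_envQuantile_mul_worstQuantile h hv]
  have hQ := isQuantileOf_worst (μ := μ) hg hF h hσ
  have hW' := hW
  have e := funext (worstQuantile_eq h μ σ)
  rw [e] at hQ hW'
  rw [rho_eq_of_quantile hg hF h hQ hW']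
  congr 1
  have := integral_mul_tilted hF h hW
  simp only [worstQuantile_eq h] at this ⊢
  rw [this]
  simp only [mul_comm]

/-- Lagrangian sufficiency; `hbind` is complementary slackness. -/
lemma isUniqueWorstCase_worstDist (hg : IsRegular g) (hF : IsM2 F)
    (h : MemLp (envDeriv g F l) 2 unif) (hv : 0 < variance (envQuantile g F l) unif)
    (hσ : 0 < σ) {ε : ℝ} (hl : 0 ≤ l)
    (hd : dW F (worstDist g F μ σ l) ≤ √ε)
    (hbind : l = 0 ∨ dW F (worstDist g F μ σ l) = √ε) :
    IsUniqueWorstCase g (uncertaintySet F μ σ ε) (worstDist g F μ σ l) := by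
  have hf := hF.memLp_quantile
  have hW := memLp_worstQuantile (μ := μ) (σ := σ) h
  have hQW := isQuantileOf_worst (μ := μ) hg hF h hσ.le
  have hP : MemLp (envQuantile g F l) 2 unif := memLp_comp_one_sub h
  have hmem := worstDist_mem hg hF h hv hσ.le hd
  have hrho := rho_worstDist (μ := μ) hg hF h hv hσ.le
  have hW2 := integral_sq_worstQuantile (μ := μ) (σ := σ) h hv
  set b := √(variance (envQuantile g F l) unif) with hb
  have hb0 : 0 < b := Real.sqrt_pos.2 hv
  set a := ∫ t, envQuantile g F l t ∂unif with ha
  -- The dual bound with the Cauchy–Schwarz deficit kept as a squared distance. Dropping it gives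
  -- optimality, and its vanishing gives uniqueness.
  have key : ∀ G ∈ uncertaintySet F μ σ ε,
      rho g G ≤ ((μ * a + σ * b - l * ∫ t, quantile F t * worstQuantile g F μ σ l t ∂unif -
        b / (2 * σ) * ∫ t, (quantile G t - worstQuantile g F μ σ l t) ^ 2 ∂unif : ℝ) : EReal) := by
    rintro G ⟨hG, hG1, hG2, hGd⟩
    have := hG.1
    have hq := hG.memLp_quantile
    have hQ := isQuantileOf_quantile G
    have hmean : ∫ x, x ∂G = ∫ t, quantile G t ∂unif := hQ.integral_comp continuous_id
    rw [hmean] at hG1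
    rw [hQ.integral_comp (continuous_pow 2)] at hG2
    refine (rho_le_integral hg hF h hQ hq).trans ?_
    rw [EReal.coe_le_coe_iff, integral_mul_tilted hF h hq, integral_sub_sq hq hW, hG2, hW2]
    have h1 := integral_mul_worstQuantile (μ := μ) (σ := σ) h hq
    have h2 := integral_mul_eq hq hP
    rw [hG1] at h1 h2
    rw [← hb] at h1
    -- With equal second moments, being no farther from `F` than the candidate means having at least
    -- its inner product with the quantile function of `F`.
    have h3 : l * ∫ t, quantile F t * worstQuantile g F μ σ l t ∂unif ≤
        l * ∫ t, quantile F t * quantile G t ∂unif := by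
      rcases hbind with rfl | hbind
      · simp
      refine mul_le_mul_of_nonneg_left ?_ hl
      rw [dW_comm, dW_eq_of_quantile hQ, integral_sub_sq hf hq, hG2] at hGd
      rw [dW_eq_of_quantile hQW, integral_sub_sq hf hW, hW2] at hbind
      rw [← hbind] at hGd
      have hnn : 0 ≤ ∫ t, quantile F t ^ 2 ∂unif -
          2 * ∫ t, quantile F t * worstQuantile g F μ σ l t ∂unif + (μ ^ 2 + σ ^ 2) := by
        rw [← hW2, ← integral_sub_sq hf hW]
        exact integral_nonneg fun t => sq_nonneg _
      have := (Real.sqrt_le_sqrt_iff hnn).1 hGd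
      linarith
    set c := covariance (quantile G) (envQuantile g F l) unif
    -- The coefficient `b / (2 * σ)` makes the deficit equal to `σ * b - c`, the loss in the
    -- covariance with the envelope derivative.
    have h4 : b / (2 * σ) * (μ ^ 2 + σ ^ 2 -
        2 * ∫ t, quantile G t * worstQuantile g F μ σ l t ∂unif + (μ ^ 2 + σ ^ 2)) =
        σ * b - c := by
      rw [h1]; field_simp; ring
    rw [h4, h2]
    linarith
  have hcoef : 0 < b / (2 * σ) := by positivity
  refine ⟨hmem, ⟨_, hrho⟩, le_antisymm (iSup₂_le fun G hG => ?_)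
    (le_iSup₂ (f := fun G _ => rho g G) _ hmem), fun G hG heq => ?_⟩
  · rw [hrho]
    refine (key G hG).trans (EReal.coe_le_coe_iff.2 (sub_le_self _ ?_))
    exact mul_nonneg hcoef.le (integral_nonneg fun t => sq_nonneg _)
  · have hle := key G hG
    rw [heq, hrho, EReal.coe_le_coe_iff] at hle
    have hGM := hG.1
    have := hGM.1
    have := hmem.1.1
    have hI : ∫ t, (quantile G t - worstQuantile g F μ σ l t) ^ 2 ∂unif ≤ 0 := by
      by_contra! hpos
      linarith [mul_pos hcoef hpos]
    have hI0 := le_antisymm hI (integral_nonneg fun t => sq_nonneg _)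
    have hae := (integral_eq_zero_iff_of_nonneg (fun t => sq_nonneg _)
      (hGM.memLp_quantile.sub hW).integrable_sq).1 hI0
    rw [← (isQuantileOf_quantile G).map_eq, ← hQW.map_eq]
    refine Measure.map_congr ?_
    filter_upwards [hae] with t ht
    exact sub_eq_zero.1 (pow_eq_zero_iff two_ne_zero |>.1 ht)

end Worst

/-! ### Existence of the multiplier and the degenerate case -/

section Existence

variable {g : ℝ → ℝ} {F : Measure ℝ}

lemma variance_envQuantile_pos (hg : IsRegular g) (hF : IsM2 F)
    (h2 : MemLp (rightDeriv (concaveEnv g)) 2 unif) {l : ℝ} (hl : 0 ≤ l)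
    (hc : ¬ IsConstant (envDeriv g F l)) : 0 < variance (envQuantile g F l) unif := by
  have h := memLp_envDeriv hg hF h2 hl
  rw [variance_comp_one_sub h]
  exact variance_pos_of_antitoneOn h (antitoneOn_rightDeriv (isRegular_tilt hg hF l).concaveOn_env)
    hc

lemma c0_of_isConstant (hc : IsConstant (rightDeriv (concaveEnv g))) : c0 g F = 0 := by
  obtain ⟨c, hc⟩ := hc
  have hv : variance (fun v => rightDeriv (concaveEnv g) (1 - v)) unif = 0 := by
    refine variance_eq_zero_of_const (c := c) ?_
    filter_upwards [ae_unif_mem] with t ht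
    exact hc _ ⟨by linarith [ht.2], by linarith [ht.1]⟩
  rw [c0, corr, hv, Real.sqrt_zero, mul_zero, div_zero]

/-- Intermediate value theorem on an interval of positive multipliers, where the variance is
positive. A correlation below `κ` comes from continuity at `0` or, if the envelope is linear, from
the strict gap; one above `κ` comes from the limit at infinity. -/
lemma exists_envCorr_eq (hg : IsRegular g) (hF : IsM2 F)
    (h2 : MemLp (rightDeriv (concaveEnv g)) 2 unif) (hσF : 0 < stdDev F)
    (hv : ∀ l, 0 < l → 0 < variance (envQuantile g F l) unif)
    (hcases : ¬ IsConstant (rightDeriv (concaveEnv g)) ∨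
      ∀ t ∈ Ioo (0 : ℝ) 1, g t < concaveEnv g t)
    {κ : ℝ} (hκ0 : c0 g F < κ) (hκ1 : κ < 1) : ∃ l, 0 < l ∧ envCorr g F l = κ := by
  have hf0 : 0 < variance (quantile F) unif := by
    rw [hF.stdDev_eq] at hσF
    exact Real.sqrt_pos.1 hσF
  obtain ⟨l₁, hl₁, h₁⟩ : ∃ l, 0 < l ∧ envCorr g F l < κ := by
    by_cases hc : IsConstant (rightDeriv (concaveEnv g))
    · have hlt := hcases.resolve_left (not_not.2 hc)
      rw [c0_of_isConstant hc] at hκ0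
      refine exists_envCorr_lt_of_linear hg hF h2 (fun t ht => ?_) hf0 hv hκ0
      rw [← hg.env_eq_linear hc ⟨ht.1.le, ht.2.le⟩]
      exact hlt t ht
    · rw [← envDeriv_zero g F] at hc
      have hcont := continuousWithinAt_envCorr hg hF h2 le_rfl hf0
        (variance_envQuantile_pos hg hF h2 le_rfl hc)
      rw [c0_eq] at hκ0
      have := (hcont.mono Ioi_subset_Ici_self).eventually (gt_mem_nhds hκ0)
      obtain ⟨l, hl, hl0⟩ := (this.and self_mem_nhdsWithin).exists
      exact ⟨l, hl0, hl⟩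
  obtain ⟨l₂, h₂, hl₂⟩ := (((tendsto_envCorr_atTop hg hF h2 hf0).eventually
    (lt_mem_nhds hκ1)).and (eventually_gt_atTop 0)).exists
  have hpos : ∀ l ∈ uIcc l₁ l₂, 0 < l := fun l hl => (lt_min hl₁ hl₂).trans_le hl.1
  have hcont : ContinuousOn (envCorr g F) (uIcc l₁ l₂) := fun l hl =>
    (continuousWithinAt_envCorr hg hF h2 (hpos l hl).le hf0 (hv l (hpos l hl))).mono
      fun r hr => (hpos r hr).le
  obtain ⟨l, hl, heq⟩ := intermediate_value_uIcc hcont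
    (show κ ∈ uIcc (envCorr g F l₁) (envCorr g F l₂) from
      ⟨(min_le_left _ _).trans h₁.le, h₂.le.trans (le_max_right _ _)⟩)
  exact ⟨l, hpos l hl, heq⟩

/-- The bound at multiplier `0` is `g 1` times the mean. It is approached along `worstDist` as `l →
0+`. -/
lemma iSup_rho_of_isConstant (hg : IsRegular g) (hF : IsM2 F)
    (h2 : MemLp (rightDeriv (concaveEnv g)) 2 unif) (hσF : 0 < stdDev F)
    (hv : ∀ l, 0 < l → 0 < variance (envQuantile g F l) unif)
    (hc : IsConstant (rightDeriv (concaveEnv g))) {μ σ ε : ℝ} (hσ : 0 < σ)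
    (hε : (mean F - μ) ^ 2 + (stdDev F - σ) ^ 2 + 2 * stdDev F * σ ≤ ε) :
    (⨆ G ∈ uncertaintySet F μ σ ε, rho g G) = ((g 1 * μ : ℝ) : EReal) := by
  refine le_antisymm (iSup₂_le fun G hG => ?_) ?_
  · obtain ⟨hGM, hG1, -⟩ := hG
    have := hGM.1
    have hQ := isQuantileOf_quantile G
    have hmean : ∫ x, x ∂G = ∫ t, quantile G t ∂unif := hQ.integral_comp continuous_id
    rw [hmean] at hG1
    obtain ⟨c, hc'⟩ := hc
    have hcg : c = g 1 := by
      rw [← hg.integral_env, integral_congr_ae (g := fun _ => c)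
        (ae_unif_mem.mono fun t ht => hc' t ht)]
      simp
    refine (rho_le_integral hg hF (memLp_envDeriv hg hF h2 le_rfl) hQ
      hGM.memLp_quantile).trans (EReal.coe_le_coe_iff.2 (le_of_eq ?_))
    rw [← hG1, ← integral_const_mul]
    refine integral_congr_ae ?_
    filter_upwards [ae_unif_mem] with t ht
    rw [envDeriv_zero, hc' _ ⟨by linarith [ht.2], by linarith [ht.1]⟩, hcg]
    ring
  -- A lower bound for the value at `worstDist`: the terms with the mean of `F` cancel, the
  -- nonnegative standard deviation term is dropped, and the correlation is at most `1`.
  · have hlim : Tendsto (fun l : ℝ => ((g 1 * μ - l * (stdDev F * σ) : ℝ) : EReal)) (𝓝[>] 0)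
        (𝓝 ((g 1 * μ : ℝ) : EReal)) := by
      refine (continuous_coe_real_ereal.tendsto _).comp ?_
      have : ContinuousAt (fun l : ℝ => g 1 * μ - l * (stdDev F * σ)) 0 := by fun_prop
      have h := this.tendsto.mono_left (nhdsWithin_le_nhds (s := Ioi 0))
      simpa using h
    refine le_of_tendsto hlim ?_
    filter_upwards [self_mem_nhdsWithin] with l hl
    have hl0 : 0 < l := hl
    have h := memLp_envDeriv hg hF h2 hl0.le
    have hvl := hv l hl0
    have hκ1 : envCorr g F l ≤ 1 := corr_le_one hF.memLp_quantile (memLp_comp_one_sub h)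
    have hκ0 : 0 ≤ envCorr g F l := by
      have := variance_envQuantile_le hg hF h2 hc hl0.le
      exact div_nonneg (pos_of_mul_pos_right (hvl.trans_le this) hl0.le).le (by positivity)
    have hmem : worstDist g F μ σ l ∈ uncertaintySet F μ σ ε := by
      refine worstDist_mem hg hF h hvl hσ.le ?_
      rw [dW_worstDist hg hF h hvl hσF hσ.le]
      refine Real.sqrt_le_sqrt (le_trans ?_ hε)
      have : 0 ≤ 2 * stdDev F * σ * envCorr g F l := by positivity
      linarith
    refine le_trans ?_ (le_iSup₂ (f := fun G _ => rho g G) _ hmem)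
    rw [rho_worstDist hg hF h hvl hσ.le, EReal.coe_le_coe_iff,
      integral_quantile_mul_worstQuantile hF h hσF, integral_envQuantile hg hF, ← hF.mean_eq]
    have h1 : 0 ≤ σ * √(variance (envQuantile g F l) unif) := by positivity
    have h2 : l * (stdDev F * σ) * envCorr g F l ≤ l * (stdDev F * σ) :=
      mul_le_of_le_one_right (by positivity) hκ1
    linarith

end Existence

end Distortion

theorem theorem1
    (g : ℝ → ℝ) (hg : Distortion.IsDistortion g)
    (husc : ∀ x ∈ Set.Icc (0 : ℝ) 1, g x = Distortion.uscVersion g x)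
    (F : MeasureTheory.Measure ℝ) (hF : Distortion.IsM2 F)
    (hσF : 0 < Distortion.stdDev F)
    (μ σ ε : ℝ) (hσ : 0 < σ) (hε : 0 < ε)
    (hA1 : MeasureTheory.IntegrableOn
      (fun t => (Distortion.rightDeriv (Distortion.concaveEnv g) t) ^ 2) (Set.Ioo (0 : ℝ) 1))
    (hA2 : ∀ lam : ℝ, 0 < lam → ¬ Distortion.IsConstant (Distortion.envDeriv g F lam)) :
    -- intermediate radii
    ((Distortion.mean F - μ) ^ 2 + (Distortion.stdDev F - σ) ^ 2 < ε →
      ε < (Distortion.mean F - μ) ^ 2 + (Distortion.stdDev F - σ) ^ 2 +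
        2 * Distortion.stdDev F * σ * (1 - Distortion.c0 g F) →
      (¬ Distortion.IsConstant (Distortion.rightDeriv (Distortion.concaveEnv g)) ∨
        ∀ t ∈ Set.Ioo (0 : ℝ) 1, g t < Distortion.concaveEnv g t) →
      (∃ lam : ℝ, 0 < lam ∧
        Distortion.dW F (Distortion.worstDist g F μ σ lam) = Real.sqrt ε) ∧
      ∀ lam : ℝ, 0 < lam →
        Distortion.dW F (Distortion.worstDist g F μ σ lam) = Real.sqrt ε →
        (∀ t ∈ Set.Ioo (0 : ℝ) 1, Distortion.quantile (Distortion.worstDist g F μ σ lam) t =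
          Distortion.worstQuantile g F μ σ lam t) ∧
        Distortion.IsUniqueWorstCase g (Distortion.uncertaintySet F μ σ ε)
          (Distortion.worstDist g F μ σ lam)) ∧
    -- large radii
    ((Distortion.mean F - μ) ^ 2 + (Distortion.stdDev F - σ) ^ 2 +
        2 * Distortion.stdDev F * σ * (1 - Distortion.c0 g F) ≤ ε →
      (¬ Distortion.IsConstant (Distortion.rightDeriv (Distortion.concaveEnv g)) →
        (∀ t ∈ Set.Ioo (0 : ℝ) 1, Distortion.quantile (Distortion.worstDist g F μ σ 0) t =
          Distortion.worstQuantile g F μ σ 0 t) ∧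
        Distortion.IsUniqueWorstCase g (Distortion.uncertaintySet F μ σ ε)
          (Distortion.worstDist g F μ σ 0)) ∧
      (Distortion.IsConstant (Distortion.rightDeriv (Distortion.concaveEnv g)) →
        (⨆ G ∈ Distortion.uncertaintySet F μ σ ε, Distortion.rho g G) =
          ((g 1 * μ : ℝ) : EReal))) := by
  have hgr := hg.isRegular husc
  have h2 : MemLp (Distortion.rightDeriv (Distortion.concaveEnv g)) 2 Distortion.unif :=
    (memLp_two_iff_integrable_sq hgr.integrable_env.aestronglyMeasurable).2 hA1
  have hv : ∀ l, 0 < l → 0 < variance (Distortion.envQuantile g F l) Distortion.unif :=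
    fun l hl => Distortion.variance_envQuantile_pos hgr hF h2 hl.le (hA2 l hl)
  have hsσ : 0 < 2 * Distortion.stdDev F * σ := by positivity
  refine ⟨fun hε1 hε2 hcases => ⟨?_, fun l hl hd => ⟨fun t ht => ?_, ?_⟩⟩,
    fun hε1 => ⟨fun hc => ?_, fun hc => ?_⟩⟩
  · set T := (Distortion.mean F - μ) ^ 2 + (Distortion.stdDev F - σ) ^ 2 with hT
    -- This `κ` solves `T + 2 σ_F σ (1 - κ) = ε`; the two bounds on `ε` say that `c₀ < κ < 1`.
    obtain ⟨l, hl, heq⟩ := Distortion.exists_envCorr_eq hgr hF h2 hσF hv hcases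
      (κ := 1 - (ε - T) / (2 * Distortion.stdDev F * σ))
      (by
        have : (ε - T) / (2 * Distortion.stdDev F * σ) < 1 - Distortion.c0 g F := by
          rw [div_lt_iff₀ hsσ]; linarith
        linarith)
      (by
        have : 0 < (ε - T) / (2 * Distortion.stdDev F * σ) := div_pos (by linarith) hsσ
        linarith)
    refine ⟨l, hl, ?_⟩
    rw [Distortion.dW_worstDist hgr hF (Distortion.memLp_envDeriv hgr hF h2 hl.le) (hv l hl) hσF
      hσ.le, heq, sub_sub_cancel, mul_div_cancel₀ _ hsσ.ne', ← hT, add_sub_cancel]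
  · exact (Distortion.isQuantileOf_worst hgr hF (Distortion.memLp_envDeriv hgr hF h2 hl.le)
      hσ.le).quantile_eq ht
  · exact Distortion.isUniqueWorstCase_worstDist hgr hF
      (Distortion.memLp_envDeriv hgr hF h2 hl.le) (hv l hl) hσ hl.le hd.le (Or.inr hd)
  · have h := Distortion.memLp_envDeriv hgr hF h2 le_rfl
    have hv0 : 0 < variance (Distortion.envQuantile g F 0) Distortion.unif :=
      Distortion.variance_envQuantile_pos hgr hF h2 le_rfl (by rwa [Distortion.envDeriv_zero])
    refine ⟨fun t ht => (Distortion.isQuantileOf_worst hgr hF h hσ.le).quantile_eq ht,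
      Distortion.isUniqueWorstCase_worstDist hgr hF h hv0 hσ le_rfl ?_ (Or.inl rfl)⟩
    rw [Distortion.dW_worstDist hgr hF h hv0 hσF hσ.le, ← Distortion.c0_eq]
    exact Real.sqrt_le_sqrt hε1
  · refine Distortion.iSup_rho_of_isConstant hgr hF h2 hσF hv hc hσ ?_
    rwa [Distortion.c0_of_isConstant hc, sub_zero, mul_one] at hε1
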